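/- Let $n\ge 1$, $0\le k\le n$, $r\ge 0$ be integers. Let $\Omega\subset\mathbb R^n$ be a bounded polyhedral domain with a conforming triangulation $\mathcal T_h$ by $n$-simplices ($\Omega$ is the interior of their union) which is shape-regular with constant $\gamma>0$: every $K\in\mathcal T_h$ contains a ball of radius $h_K/\gamma$, where $h_K=\operatorname{diam}K$; put $h=\max_K h_K$. Write $(\cdot,\cdot)_U$, $\|\cdot\|_U$ for the $L^2$ inner product and norm of differential forms on $U$, $(\cdot,\cdot)_{\mathcal T_h}=\sum_K(\cdot,\cdot)_K$, $\langle\cdot,\cdot\rangle_{\partial K}$ for the $L^2$ inner product on $\partial K$, $\langle\cdot,\cdot\rangle_{\partial\mathcal T_h}=\sum_K\langle\cdot,\cdot\rangle_{\partial K}$, and $$|||\cdot|||_{\partial K}=h_K^{1/2}\|\cdot\|_{\partial K},\qquad |||\cdot|||_{\partial\mathcal T_h}=\Bigl(\sum_K|||\cdot|||_{\partial K}^2\Bigr)^{1/2}.$$ $\tau^{\mathrm{tan}}$ is the pullback of $\tau$ to the facets of $K$; the weak normal trace $v^{\mathrm{nor}}$ of $v\in L^2\Lambda^{j}(K)$ with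 weak codifferential $\delta v\in L^2$ is given by $\langle \tau^{\mathrm{tan}},v^{\mathrm{nor}}\rangle_{\partial K}=(d\tau,v)_K-(\tau,\delta v)_K$. Exact problem: given $f\in L^2\Lambda^k(\Omega)$, let $(\sigma,u,p)\in H\Lambda^{k-1}(\Omega)\times H\Lambda^k(\Omega)\times\mathfrak H^k$ satisfy $(\sigma,\tau)_\Omega-(u,d\tau)_\Omega=0$ for all $\tau\in H\Lambda^{k-1}(\Omega)$, $(d\sigma,v)_\Omega+(du,dv)_\Omega+(p,v)_\Omega=(f,v)_\Omega$ for all $v\in H\Lambda^k(\Omega)$, $(u,q)_\Omega=0$ for all $q\in\mathfrak H^k$, where $\mathfrak H^k$ is the space of closed forms orthogonal to $dH\Lambda^{k-1}(\Omega)$. Put $\rho=du$. Discrete spaces: on each $K$ let $W_h^{k-1}(K)$ be $\mathcal P_{r+1}\Lambda^{k-1}(K)$ or $\mathcal P_{r+1}^-\Lambda^{k-1}(K)$, and $W_h^k(K)$ be $\mathcal P_r\Lambda^k(K)$ (if $r\ge1$) or $\mathcal P_{r+1}^-\Lambda^k(K)$ (the same choices on all $K$), and let $W_h^{k+1}(K)\subset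 H\Lambda^{k+1}(K)$ be any finite-dimensional space containing $dW_h^k(K)$. Let $W_h^j=\prod_KW_h^j(K)$ and, for $j=k-1,k$, $V_h^j=W_h^j\cap H\Lambda^j(\Omega)$, $\widehat W_h^{j,\mathrm{tan}}=\{v_h^{\mathrm{tan}}:v_h\in W_h^j\}\subset L^2\Lambda^j(\partial\mathcal T_h)$, $\widehat V_h^{j,\mathrm{tan}}=\{v_h^{\mathrm{tan}}:v_h\in V_h^j\}$; the dual $\widehat W_h^{j,\mathrm{nor}}$ of $\widehat W_h^{j,\mathrm{tan}}$ is identified with $\widehat W_h^{j,\mathrm{tan}}$ by $\langle\cdot,\cdot\rangle_{\partial\mathcal T_h}$. Let $\mathfrak H_h^k=\{q\in V_h^k:dq=0,\ q\perp dV_h^{k-1}\}$ and let $\overline{\mathfrak H}_h^k$ be the space of $q\in W_h^k$ such that on each $K$: $q^{\mathrm{tan}}=0$, $dq=0$ and $(q,d\tau)_K=0$ for all $\tau\in W_h^{k-1}(K)$ with $\tau^{\mathrm{tan}}=0$. Hybridized method: let $\sigma_h\in W_h^{k-1}$, $u_h\in W_h^k$, $\bar p_h,\bar u_h\in\overline{\mathfrak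 H}_h^k$, $\widehat u_h^{\mathrm{nor}}\in\widehat W_h^{k-1,\mathrm{nor}}$, $\widehat\rho_h^{\mathrm{nor}}\in\widehat W_h^{k,\mathrm{nor}}$, $p_h\in\mathfrak H_h^k$, $\widehat\sigma_h^{\mathrm{tan}}\in\widehat V_h^{k-1,\mathrm{tan}}$, $\widehat u_h^{\mathrm{tan}}\in\widehat V_h^{k,\mathrm{tan}}$ satisfy $$\begin{aligned} (\sigma_h,\tau_h)_{\mathcal T_h}-(u_h,d\tau_h)_{\mathcal T_h}+\langle\widehat u_h^{\mathrm{nor}},\tau_h^{\mathrm{tan}}\rangle_{\partial\mathcal T_h}&=0,\\ (d\sigma_h,v_h)_{\mathcal T_h}+(du_h,dv_h)_{\mathcal T_h}+(\bar p_h+p_h,v_h)_{\mathcal T_h}-\langle\widehat\rho_h^{\mathrm{nor}},v_h^{\mathrm{tan}}\rangle_{\partial\mathcal T_h}&=(f,v_h)_{\mathcal T_h},\\ (\bar u_h-u_h,\bar q_h)_{\mathcal T_h}=0,\quad (u_h,q_h)_{\mathcal T_h}=0,\quad(\bar p_h,\bar v_h)_{\mathcal T_h}&=0,\\ \langle\widehat\sigma_h^{\mathrm{tan}}-\sigma_h^{\mathrm{tan}},\widehat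 v_h^{\mathrm{nor}}\rangle_{\partial\mathcal T_h}=0,\quad\langle\widehat u_h^{\mathrm{tan}}-u_h^{\mathrm{tan}},\widehat\eta_h^{\mathrm{nor}}\rangle_{\partial\mathcal T_h}&=0,\\ \langle\widehat u_h^{\mathrm{nor}},\widehat\tau_h^{\mathrm{tan}}\rangle_{\partial\mathcal T_h}=0,\quad\langle\widehat\rho_h^{\mathrm{nor}},\widehat v_h^{\mathrm{tan}}\rangle_{\partial\mathcal T_h}&=0 \end{aligned}$$ for all $\tau_h\in W_h^{k-1}$, $v_h\in W_h^k$, $\bar q_h,\bar v_h\in\overline{\mathfrak H}_h^k$, $q_h\in\mathfrak H_h^k$, $\widehat v_h^{\mathrm{nor}}\in\widehat W_h^{k-1,\mathrm{nor}}$, $\widehat\eta_h^{\mathrm{nor}}\in\widehat W_h^{k,\mathrm{nor}}$, $\widehat\tau_h^{\mathrm{tan}}\in\widehat V_h^{k-1,\mathrm{tan}}$, $\widehat v_h^{\mathrm{tan}}\in\widehat V_h^{k,\mathrm{tan}}$. Let $\widehat P_hu^{\mathrm{nor}}\in\widehat W_h^{k-1,\mathrm{nor}}$ and $\widehat P_h\rho^{\mathrm{nor}}\in\widehat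 W_h^{k,\mathrm{nor}}$ have the same pairings as $u^{\mathrm{nor}}$ and $\rho^{\mathrm{nor}}$ with all elements of $\widehat W_h^{k-1,\mathrm{tan}}$ and $\widehat W_h^{k,\mathrm{tan}}$, respectively, and let $P_h$ be the $L^2$ projection onto $W_h^k$ (for $u$) and onto $W_h^{k+1}$ (for $d(u-u_h)$). Then there is a constant $C$, depending only on $n,k,r,\gamma$ and the choice of the element families, such that for each $K\in\mathcal T_h$ $$|||\widehat P_hu^{\mathrm{nor}}-\widehat u_h^{\mathrm{nor}}|||_{\partial K}\le C\bigl(\|P_hu-u_h\|_K+h_K\|\sigma-\sigma_h\|_K\bigr),$$ $$|||\widehat P_h\rho^{\mathrm{nor}}-\widehat\rho_h^{\mathrm{nor}}|||_{\partial K}\le C\bigl(\|P_hd(u-u_h)\|_K+h_K(\|d(\sigma-\sigma_h)\|_K+\|p-p_h\|_K)\bigr),$$ and consequently $$|||\widehat P_hu^{\mathrm{nor}}-\widehat u_h^{\mathrm{nor}}|||_{\partial\mathcal T_h}\le C\bigl(\|P_hu-u_h\|_{\mathcal T_h}+h\|\sigma-\sigma_h\|_\Omega\bigr),$$ $$|||\widehat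 P_h\rho^{\mathrm{nor}}-\widehat\rho_h^{\mathrm{nor}}|||_{\partial\mathcal T_h}\le C\bigl(\|P_hd(u-u_h)\|_{\mathcal T_h}+h(\|d(\sigma-\sigma_h)\|_\Omega+\|p-p_h\|_\Omega)\bigr).$$ -/

import Mathlib

open MeasureTheory
open scoped ContDiff

noncomputable section

namespace HybridFEEC

/-! ### Exterior algebra -/

/-- Alternating forms, with the degree shifted by one so that degree `-1` is available:
`Alt V 0 = 0` is the (trivial) space of `(-1)`-forms and `Alt V (k + 1)` is the space of
alternating `k`-linear forms on `V`. -/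
def Alt (V : Type) [NormedAddCommGroup V] [NormedSpace ℝ V] : ℕ → Type
  | 0 => PUnit
  | k + 1 => V [⋀^Fin k]→L[ℝ] ℝ

section

variable {V W : Type} [NormedAddCommGroup V] [NormedSpace ℝ V]
  [NormedAddCommGroup W] [NormedSpace ℝ W]

instance instNormedAddCommGroupAlt : ∀ j : ℕ, NormedAddCommGroup (Alt V j)
  | 0 => inferInstanceAs (NormedAddCommGroup PUnit)
  | k + 1 => inferInstanceAs (NormedAddCommGroup (V [⋀^Fin k]→L[ℝ] ℝ))

instance instNormedSpaceAlt : ∀ j : ℕ, NormedSpace ℝ (Alt V j)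
  | 0 => inferInstanceAs (NormedSpace ℝ PUnit)
  | k + 1 => inferInstanceAs (NormedSpace ℝ (V [⋀^Fin k]→L[ℝ] ℝ))

instance instAddCommGroupAlt (j : ℕ) : AddCommGroup (Alt V j) :=
  (instNormedAddCommGroupAlt j).toAddCommGroup

instance instModuleAlt (j : ℕ) : Module ℝ (Alt V j) :=
  (instNormedSpaceAlt j).toModule

/-- The inner product on alternating `k`-forms in terms of an orthonormal basis `b` of `V`.
Summing over all index maps `Fin k → ι` and dividing by `k!` is the same as summing over the
increasing multi-indices, since the summand is symmetric and vanishes on non-injective maps. -/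
def altInner {ι : Type} [Fintype ι] (b : ι → V) : ∀ j : ℕ, Alt V j → Alt V j → ℝ
  | 0, _, _ => 0
  | k + 1, α, β =>
      let α' : V [⋀^Fin k]→L[ℝ] ℝ := α
      let β' : V [⋀^Fin k]→L[ℝ] ℝ := β
      ((k.factorial : ℝ))⁻¹ * ∑ I : Fin k → ι, α' (fun i => b (I i)) * β' (fun i => b (I i))

/-- The interior product `ι_v α`; it vanishes on `0`-forms. -/
def contract (v : V) : ∀ j : ℕ, Alt V (j + 1) →ₗ[ℝ] Alt V j
  | 0 => 0
  | k + 1 =>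
      { toFun := fun α =>
          (ContinuousAlternatingMap.curryLeft (show V [⋀^Fin (k + 1)]→L[ℝ] ℝ from α) v :
            V [⋀^Fin k]→L[ℝ] ℝ)
        map_add' := fun _ _ => rfl
        map_smul' := fun _ _ => rfl }

/-- The pullback `A^* α` of an alternating form by a linear map. -/
def pullback (A : V →L[ℝ] W) : ∀ j : ℕ, Alt W j →ₗ[ℝ] Alt V j
  | 0 => 0
  | k + 1 =>
      { toFun := fun α =>
          (ContinuousAlternatingMap.compContinuousLinearMap
            (show W [⋀^Fin k]→L[ℝ] ℝ from α) A : V [⋀^Fin k]→L[ℝ] ℝ)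
        map_add' := fun _ _ => rfl
        map_smul' := fun _ _ => rfl }

end

/-! ### Differential forms on subsets of Euclidean space -/

/-- `n`-dimensional Euclidean space. -/
abbrev Euc (n : ℕ) : Type := EuclideanSpace ℝ (Fin n)

/-- Differential forms on `ℝⁿ` (no regularity): `Form n 0` are the `(-1)`-forms (zero), and
`Form n (k + 1)` are the `k`-forms. -/
abbrev Form (n j : ℕ) : Type := Euc n → Alt (Euc n) j

variable {n : ℕ}

/-- The exterior derivative of a differentiable form. -/
def extD : ∀ j : ℕ, Form n j → Form n (j + 1)
  | 0, _ => 0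
  | k + 1, α => extDeriv (show Euc n → Euc n [⋀^Fin k]→L[ℝ] ℝ from α)

/-- The codifferential `δ η = - ∑ i, ι_{e_i} (∂_i η)` of a differentiable form on `ℝⁿ`
(the coordinate expression of `(-1)^k ⋆⁻¹ d ⋆` on `k`-forms). -/
def codiff (j : ℕ) (η : Form n (j + 1)) : Form n j := fun x =>
  - ∑ i : Fin n, contract (EuclideanSpace.single i (1 : ℝ)) j
      (fderiv ℝ η x (EuclideanSpace.single i (1 : ℝ)))

/-- The `L²` inner product `(α, β)_U`. -/
def ip {j : ℕ} (U : Set (Euc n)) (α β : Form n j) : ℝ :=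
  ∫ x in U, altInner (fun i : Fin n => EuclideanSpace.single i (1 : ℝ)) j (α x) (β x)

/-- The `L²` norm `‖α‖_U`. -/
def nrm {j : ℕ} (U : Set (Euc n)) (α : Form n j) : ℝ := √(ip U α α)

/-- `α ∈ L² Λ(U)`. -/
def MemL2 {j : ℕ} (U : Set (Euc n)) (α : Form n j) : Prop := MemLp α 2 (volume.restrict U)

/-- Smooth forms with compact support in the open set `U`. -/
def IsTest {j : ℕ} (U : Set (Euc n)) (η : Form n j) : Prop :=
  ContDiff ℝ ∞ η ∧ HasCompactSupport η ∧ tsupport η ⊆ U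

/-- `v ∈ H Λ(U)` with weak exterior derivative `w`. -/
def IsWeakD {j : ℕ} (U : Set (Euc n)) (v : Form n j) (w : Form n (j + 1)) : Prop :=
  MemL2 U v ∧ MemL2 U w ∧ ∀ η : Form n (j + 1), IsTest U η → ip U w η = ip U v (codiff j η)

/-- `v ∈ H^* Λ(U)` with weak codifferential `w`. -/
def IsWeakCodiff {j : ℕ} (U : Set (Euc n)) (v : Form n (j + 1)) (w : Form n j) : Prop :=
  MemL2 U v ∧ MemL2 U w ∧ ∀ τ : Form n j, IsTest U τ → ip U τ w = ip U (extD j τ) v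

/-- Harmonic forms on `Ω` (natural boundary conditions): closed and orthogonal to all exact
forms. -/
def IsHarmonic {j : ℕ} (Ω : Set (Euc n)) (p : Form n (j + 1)) : Prop :=
  IsWeakD Ω p 0 ∧ ∀ (τ : Form n j) (dτ : Form n (j + 1)), IsWeakD Ω τ dτ → ip Ω p dτ = 0

/-- `(σ, u, p)` solves the mixed formulation of the Hodge--Laplace problem with right-hand side
`f`; `dσ` and `du` are the weak exterior derivatives of `σ` and `u`. If `u` is a `k`-form, then
`j = k`. -/
structure HodgeLaplaceSolution {j : ℕ} (Ω : Set (Euc n)) (f : Form n (j + 1))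
    (σ : Form n j) (dσ u : Form n (j + 1)) (du : Form n (j + 2)) (p : Form n (j + 1)) :
    Prop where
  sigma_mem : IsWeakD Ω σ dσ
  u_mem : IsWeakD Ω u du
  p_mem : IsHarmonic Ω p
  eq_tau : ∀ (τ : Form n j) (dτ : Form n (j + 1)), IsWeakD Ω τ dτ → ip Ω σ τ - ip Ω u dτ = 0
  eq_v : ∀ (v : Form n (j + 1)) (dv : Form n (j + 2)), IsWeakD Ω v dv →
    ip Ω dσ v + ip Ω du dv + ip Ω p v = ip Ω f v
  eq_q : ∀ q : Form n (j + 1), IsHarmonic Ω q → ip Ω u q = 0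

/-! ### Simplicial meshes -/

/-- The closed simplex with vertex set `K`. -/
def cell (K : Finset (Euc n)) : Set (Euc n) := convexHull ℝ (K : Set (Euc n))

/-- The facet of the simplex `K` opposite to the vertex `v`. -/
def facet (K : Finset (Euc n)) (v : {v // v ∈ K}) : Set (Euc n) :=
  convexHull ℝ ((K : Set (Euc n)) \ {v.1})

/-- The tangent space of the facet of `K` opposite to `v`. -/
def facetDir (K : Finset (Euc n)) (v : {v // v ∈ K}) : Submodule ℝ (Euc n) :=
  vectorSpan ℝ ((K : Set (Euc n)) \ {v.1})

/-- `h_K`, the diameter of the simplex `K`. -/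
def cellDiam (K : Finset (Euc n)) : ℝ := Metric.diam (cell K)

/-- `h`, the largest diameter of a simplex of the mesh `T`. -/
def meshSize (T : Finset (Finset (Euc n))) : ℝ := ⨆ K : {K // K ∈ T}, cellDiam K.1

/-- The finite set `T` of `n`-simplices (given by their vertex sets) is a conforming
triangulation of the polyhedral domain `Ω`: its members are the maximal faces of a simplicial
complex, and `Ω` is the interior of their union. -/
structure IsTriangulation (Ω : Set (Euc n)) (T : Finset (Finset (Euc n))) : Prop where
  exists_complex : ∃ 𝒦 : Geometry.SimplicialComplex ℝ (Euc n),
    𝒦.facets = (T : Set (Finset (Euc n))) ∧ Ω = interior 𝒦.space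
  card_eq : ∀ K ∈ T, K.card = n + 1

/-- Shape regularity with constant `γ`: each simplex `K` contains a ball of radius `h_K / γ`. -/
def ShapeRegular (γ : ℝ) (T : Finset (Finset (Euc n))) : Prop :=
  ∀ K ∈ T, ∃ c : Euc n, Metric.ball c (cellDiam K / γ) ⊆ cell K

/-! ### Broken forms

A broken form assigns to each simplex `K` of the mesh a form on `K`; its values on index sets
which are not in the mesh are irrelevant. -/

/-- Broken differential forms. -/
abbrev Broken (n j : ℕ) : Type := Finset (Euc n) → Form n j

/-- The broken inner product `(α, β)_{𝒯_h}`. -/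
def bip {j : ℕ} (T : Finset (Finset (Euc n))) (α β : Broken n j) : ℝ :=
  ∑ K ∈ T, ip (cell K) (α K) (β K)

/-- The broken norm `‖α‖_{𝒯_h}`. For `α` in `L² Λ(Ω)`, restricted to the simplices of a
triangulation of `Ω`, this is the same as `‖α‖_Ω`. -/
def bnrm {j : ℕ} (T : Finset (Finset (Euc n))) (α : Broken n j) : ℝ := √(bip T α α)

/-- The broken form `w` is (the restriction of) an element of `H Λ(Ω)`. -/
def IsUnbroken {j : ℕ} (Ω : Set (Euc n)) (T : Finset (Finset (Euc n))) (w : Broken n j) :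
    Prop :=
  ∃ (v : Form n j) (dv : Form n (j + 1)), IsWeakD Ω v dv ∧
    ∀ K ∈ T, v =ᵐ[volume.restrict (cell K)] w K

/-! ### Tangential and normal traces on the boundary of a simplex -/

/-- Fields of alternating forms on the tangent spaces of the facets of `K`. -/
abbrev TanField (K : Finset (Euc n)) (j : ℕ) : Type :=
  (v : {v // v ∈ K}) → Euc n → Alt (facetDir K v) j

instance instAddCommGroupTanField (K : Finset (Euc n)) (j : ℕ) : AddCommGroup (TanField K j) :=
  Pi.addCommGroup

instance instModuleTanField (K : Finset (Euc n)) (j : ℕ) : Module ℝ (TanField K j) :=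
  Pi.module _ _ _

open Classical in
/-- The tangential trace on `∂K`: on each facet, the pullback by the inclusion of the facet
(extended by zero off the facet). -/
def tanTrace (K : Finset (Euc n)) (j : ℕ) : Form n j →ₗ[ℝ] TanField K j :=
  LinearMap.pi fun v => LinearMap.pi fun x =>
    if x ∈ facet K v then
      (pullback (facetDir K v).subtypeL j).comp (LinearMap.proj x)
    else 0

/-- The `L²` inner product `⟨s, t⟩_{∂K}` with respect to surface measure. -/
def bdIp {j : ℕ} (K : Finset (Euc n)) (s t : TanField K j) : ℝ :=
  ∑ v : {v // v ∈ K}, ∫ x in facet K v,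
    altInner (stdOrthonormalBasis ℝ (facetDir K v)) j (s v x) (t v x)
      ∂(Measure.euclideanHausdorffMeasure (n - 1) : Measure (Euc n))

/-- The scaled norm `|||s|||_{∂K} = h_K^{1/2} ‖s‖_{∂K}`. -/
def triNorm {j : ℕ} (K : Finset (Euc n)) (s : TanField K j) : ℝ :=
  √(cellDiam K) * √(bdIp K s s)

/-- Broken boundary fields, double valued on the interfaces. -/
abbrev BrokenTan (n j : ℕ) : Type := (K : Finset (Euc n)) → TanField K j

/-- The pairing `⟨s, t⟩_{∂𝒯_h}`. -/
def bbdIp {j : ℕ} (T : Finset (Finset (Euc n))) (s t : BrokenTan n j) : ℝ :=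
  ∑ K ∈ T, bdIp K (s K) (t K)

/-- The scaled norm `|||s|||_{∂𝒯_h} = (∑_K |||s|||_{∂K}²)^{1/2}`. -/
def bTriNorm {j : ℕ} (T : Finset (Finset (Euc n))) (s : BrokenTan n j) : ℝ :=
  √(∑ K ∈ T, triNorm K (s K) ^ 2)

/-- The pairing `⟨τ^tan, v^nor⟩_{∂K} = (dτ, v)_K - (τ, δv)_K` of the tangential trace of
`τ ∈ H Λ(K)` with the weak normal trace of `v ∈ H^* Λ(K)`. -/
def traceDuality {j : ℕ} (K : Finset (Euc n)) (τ : Form n j) (dτ : Form n (j + 1))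
    (v : Form n (j + 1)) (δv : Form n j) : ℝ :=
  ip (cell K) dτ v - ip (cell K) τ δv

/-! ### Polynomial differential forms -/

/-- Real polynomial functions on `ℝⁿ` of degree at most `r`. -/
def IsPoly (r : ℕ) (g : Euc n → ℝ) : Prop :=
  ∃ P : MvPolynomial (Fin n) ℝ, P.totalDegree ≤ r ∧ ∀ x, g x = MvPolynomial.eval (fun i => x i) P

/-- `𝒫_r Λ`: forms all of whose coefficients (equivalently, all of whose compositions with
linear functionals on alternating forms) are polynomials of degree at most `r`. -/
def polyForms (n r j : ℕ) : Submodule ℝ (Form n j) where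
  carrier := {v | ∀ ℓ : Alt (Euc n) j →ₗ[ℝ] ℝ, IsPoly r fun x => ℓ (v x)}
  zero_mem' := fun ℓ => ⟨0, by simp, by simp⟩
  add_mem' := by
    intro v w hv hw ℓ
    obtain ⟨P, hP, hP'⟩ := hv ℓ
    obtain ⟨Q, hQ, hQ'⟩ := hw ℓ
    exact ⟨P + Q, (MvPolynomial.totalDegree_add P Q).trans (max_le hP hQ),
      fun x => by simp [hP' x, hQ' x]⟩
  smul_mem' := by
    intro c v hv ℓ
    obtain ⟨P, hP, hP'⟩ := hv ℓ
    exact ⟨c • P, (MvPolynomial.totalDegree_smul_le c P).trans hP,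
      fun x => by simp [hP' x]⟩

/-- The Koszul differential: contraction with the vector field `x`. -/
def koszul (n j : ℕ) : Form n (j + 1) →ₗ[ℝ] Form n j :=
  LinearMap.pi fun x => (contract x j).comp (LinearMap.proj x)

/-- `𝒫_{r+1}^- Λ = 𝒫_r Λ + κ 𝒫_r Λ`. (The index is shifted: `r` here gives `𝒫_{r+1}^-`.) -/
def trimmedForms (n r j : ℕ) : Submodule ℝ (Form n j) :=
  polyForms n r j ⊔ (polyForms n r (j + 1)).map (koszul n j)

/-- The two families `𝒫` and `𝒫^-` of polynomial forms. -/
inductive Kind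
  | full
  | trimmed

/-- The local space of `(k-1)`-forms in a stable pair: `𝒫_{r+1} Λ` or `𝒫_{r+1}^- Λ`. -/
def lowSpace (n r : ℕ) (j : ℕ) : Kind → Submodule ℝ (Form n j)
  | .full => polyForms n (r + 1) j
  | .trimmed => trimmedForms n r j

/-- The local space of `k`-forms in a stable pair: `𝒫_r Λ` (only used if `r ≥ 1`) or
`𝒫_{r+1}^- Λ`. -/
def highSpace (n r : ℕ) (j : ℕ) : Kind → Submodule ℝ (Form n j)
  | .full => polyForms n r j
  | .trimmed => trimmedForms n r j

/-! ### Discrete spaces and the hybridized method -/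

/-- `w ∈ W_h`, where each local space is `S`. -/
def MemW {j : ℕ} (T : Finset (Finset (Euc n))) (S : Submodule ℝ (Form n j)) (w : Broken n j) :
    Prop :=
  ∀ K ∈ T, w K ∈ S

/-- `w ∈ V_h = H Λ(Ω) ∩ W_h`. -/
def MemV {j : ℕ} (Ω : Set (Euc n)) (T : Finset (Finset (Euc n))) (S : Submodule ℝ (Form n j))
    (w : Broken n j) : Prop :=
  MemW T S w ∧ IsUnbroken Ω T w

/-- The space of tangential traces on `∂K` of local forms in `S`. -/
def tanSpace {j : ℕ} (K : Finset (Euc n)) (S : Submodule ℝ (Form n j)) :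
    Submodule ℝ (TanField K j) :=
  S.map (tanTrace K j)

/-- `s` is an element of the broken trace space `Ŵ_h^tan`. It is also used for its dual space
`Ŵ_h^nor`, the duality pairing being the `L²` inner product on `∂𝒯_h`. -/
def MemWhat {j : ℕ} (T : Finset (Finset (Euc n))) (S : Submodule ℝ (Form n j))
    (s : BrokenTan n j) : Prop :=
  ∀ K ∈ T, s K ∈ tanSpace K S

/-- `s` is an element of the single-valued trace space `V̂_h^tan = {v_h^tan : v_h ∈ V_h}`. -/
def MemVhat {j : ℕ} (Ω : Set (Euc n)) (T : Finset (Finset (Euc n)))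
    (S : Submodule ℝ (Form n j)) (s : BrokenTan n j) : Prop :=
  ∃ w : Broken n j, MemV Ω T S w ∧ ∀ K ∈ T, s K = tanTrace K j (w K)

/-- Elementwise exterior derivative of a piecewise smooth broken form. -/
def bD {j : ℕ} (w : Broken n j) : Broken n (j + 1) := fun K => extD j (w K)

/-- Elementwise tangential trace. -/
def bTan {j : ℕ} (w : Broken n j) : BrokenTan n j := fun K => tanTrace K j (w K)

/-- Global discrete harmonic forms: elements of `V_h` that are closed and orthogonal to
`d V_h`. Here `S₀` and `S₁` are the local spaces of `(k-1)`- and `k`-forms. -/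
def IsDiscreteHarmonic {j : ℕ} (Ω : Set (Euc n)) (T : Finset (Finset (Euc n)))
    (S₀ : Submodule ℝ (Form n j)) (S₁ : Submodule ℝ (Form n (j + 1))) (p : Broken n (j + 1)) :
    Prop :=
  MemV Ω T S₁ p ∧ (∀ K ∈ T, ∀ x ∈ cell K, extD (j + 1) (p K) x = 0) ∧
    ∀ τ : Broken n j, MemV Ω T S₀ τ → bip T p (bD τ) = 0

/-- Local discrete harmonic forms with vanishing tangential trace, on each simplex. -/
def IsLocalHarmonic {j : ℕ} (T : Finset (Finset (Euc n)))
    (S₀ : Submodule ℝ (Form n j)) (S₁ : Submodule ℝ (Form n (j + 1))) (q : Broken n (j + 1)) :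
    Prop :=
  ∀ K ∈ T, q K ∈ S₁ ∧ tanTrace K (j + 1) (q K) = 0 ∧
    (∀ x ∈ cell K, extD (j + 1) (q K) x = 0) ∧
    ∀ τ ∈ S₀, tanTrace K j τ = 0 → ip (cell K) (q K) (extD j τ) = 0

/-- The hybridized finite element method for the Hodge--Laplace problem on `k`-forms (`j = k`),
with local spaces `S₀` of `(k-1)`-forms and `S₁` of `k`-forms. The unknowns are
`σ_h`, `u_h`, `p̄_h`, `û_h^nor`, `ρ̂_h^nor` (local variables) and
`p_h`, `ū_h`, `σ̂_h^tan`, `û_h^tan` (global variables). -/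
structure HybridSolution {j : ℕ} (Ω : Set (Euc n)) (T : Finset (Finset (Euc n)))
    (S₀ : Submodule ℝ (Form n j)) (S₁ : Submodule ℝ (Form n (j + 1))) (f : Form n (j + 1))
    (σh : Broken n j) (uh pbar : Broken n (j + 1))
    (unor : BrokenTan n j) (rhonor : BrokenTan n (j + 1))
    (ph ubar : Broken n (j + 1)) (σtan : BrokenTan n j) (utan : BrokenTan n (j + 1)) :
    Prop where
  sigma_mem : MemW T S₀ σh
  u_mem : MemW T S₁ uh
  pbar_mem : IsLocalHarmonic T S₀ S₁ pbar
  unor_mem : MemWhat T S₀ unor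
  rhonor_mem : MemWhat T S₁ rhonor
  p_mem : IsDiscreteHarmonic Ω T S₀ S₁ ph
  ubar_mem : IsLocalHarmonic T S₀ S₁ ubar
  sigmatan_mem : MemVhat Ω T S₀ σtan
  utan_mem : MemVhat Ω T S₁ utan
  eq_tau : ∀ τ : Broken n j, MemW T S₀ τ →
    bip T σh τ - bip T uh (bD τ) + bbdIp T unor (bTan τ) = 0
  eq_v : ∀ v : Broken n (j + 1), MemW T S₁ v →
    bip T (bD σh) v + bip T (bD uh) (bD v) + bip T (pbar + ph) v - bbdIp T rhonor (bTan v)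
      = bip T (fun _ => f) v
  eq_qbar : ∀ q : Broken n (j + 1), IsLocalHarmonic T S₀ S₁ q → bip T (ubar - uh) q = 0
  eq_vnor : ∀ s : BrokenTan n j, MemWhat T S₀ s → bbdIp T (σtan - bTan σh) s = 0
  eq_etanor : ∀ s : BrokenTan n (j + 1), MemWhat T S₁ s → bbdIp T (utan - bTan uh) s = 0
  eq_q : ∀ q : Broken n (j + 1), IsDiscreteHarmonic Ω T S₀ S₁ q → bip T uh q = 0
  eq_vbar : ∀ v : Broken n (j + 1), IsLocalHarmonic T S₀ S₁ v → bip T pbar v = 0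
  eq_tautan : ∀ s : BrokenTan n j, MemVhat Ω T S₀ s → bbdIp T unor s = 0
  eq_vtan : ∀ s : BrokenTan n (j + 1), MemVhat Ω T S₁ s → bbdIp T rhonor s = 0

/-- `Pv = P̂_h v^nor`: the element of `Ŵ_h^nor` (identified with `Ŵ_h^tan` by the `L²` inner
product) that has the same pairing with all discrete tangential traces as the weak normal trace
of `v`. The form `v` is required to be in `H^* Λ(K)` for all simplices `K`. -/
def IsNormalTraceProj {j : ℕ} (T : Finset (Finset (Euc n))) (S : Submodule ℝ (Form n j))
    (v : Form n (j + 1)) (Pv : BrokenTan n j) : Prop :=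
  MemWhat T S Pv ∧ ∃ δv : Broken n j,
    (∀ K ∈ T, IsWeakCodiff (interior (cell K)) v (δv K)) ∧
    ∀ τ : Broken n j, MemW T S τ →
      bbdIp T Pv (bTan τ) = ∑ K ∈ T, traceDuality K (τ K) (extD j (τ K)) v (δv K)

/-- `Pw = P_h w`: elementwise `L²` projection of `w` onto the broken space whose local spaces
are `S K`. -/
def IsL2Proj {j : ℕ} (T : Finset (Finset (Euc n)))
    (S : Finset (Euc n) → Submodule ℝ (Form n j)) (w Pw : Broken n j) : Prop :=
  ∀ K ∈ T, Pw K ∈ S K ∧ ∀ s ∈ S K, ip (cell K) (w K - Pw K) s = 0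

/-- `S₂` is a possible choice of local spaces of `(k+1)`-forms on the simplices, continuing the
complex after the local space `S₁` of `k`-forms: each `S₂ K` is a finite-dimensional subspace of
`H Λ(K)` that contains `d S₁`. -/
def ContinuesComplex {j : ℕ} (T : Finset (Finset (Euc n))) (S₁ : Submodule ℝ (Form n j))
    (S₂ : Finset (Euc n) → Submodule ℝ (Form n (j + 1))) : Prop :=
  ∀ K ∈ T, Module.Finite ℝ (S₂ K) ∧ (∀ v ∈ S₁, extD j v ∈ S₂ K) ∧
    ∀ w ∈ S₂ K, ∃ dw, IsWeakD (interior (cell K)) w dw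

end HybridFEEC

end

open HybridFEEC

/-!
On a simplex `K` the error `s` of a normal trace is an element of the space of tangential traces,
so it lifts to a form `τ` in the local space, and `‖τ‖ + h_K ‖dτ‖ ≤ C |||s|||` for a suitable lift:
on a fixed reference simplex this holds because the local space is finite-dimensional, and affine
pullback carries it to `K`, shape regularity bounding the distortion.

Testing the method on `K` with `τ` alone expresses `⟨ûₕⁿᵒʳ, τᵗᵃⁿ⟩` through `σₕ` and `uₕ`. Since
`δu = σ` and `δρ = f - dσ - p` on `K` in the weak sense, the same expression in the exact solution
gives the pairing of the projected trace, and similarly for `ρ`, where moreover `p̄ₕ = 0`. Hence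
`⟨s, τᵗᵃⁿ⟩` is a sum of inner products of `τ` and `dτ` with the errors. As `⟨s, τᵗᵃⁿ⟩` is
`‖s‖² = |||s|||² / h_K`, the Cauchy–Schwarz inequality yields the local estimates, and the triangle
inequality in `ℓ²` sums them over the triangulation.
-/

noncomputable section

namespace HybridFEEC

/-! ### Alternating forms and orthonormal bases -/

section Alt

variable {V W : Type} [NormedAddCommGroup V] [NormedSpace ℝ V]
  [NormedAddCommGroup W] [NormedSpace ℝ W] {ι : Type} [Fintype ι]

/-- The continuous alternating map underlying an element of `Alt V (k + 1)`. -/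
abbrev Alt.form {k : ℕ} (α : Alt V (k + 1)) : V [⋀^Fin k]→L[ℝ] ℝ := α

theorem altInner_add_left (b : ι → V) :
    ∀ (j : ℕ) (α β ξ : Alt V j), altInner b j (α + β) ξ = altInner b j α ξ + altInner b j β ξ
  | 0, _, _, _ => by simp [altInner]
  | k + 1, α, β, ξ => by
      change (k.factorial : ℝ)⁻¹ * ∑ I : Fin k → ι,
        (α.form (fun i => b (I i)) + β.form (fun i => b (I i))) * _ = _
      simp only [add_mul, Finset.sum_add_distrib, mul_add]
      rfl

theorem altInner_smul_left (b : ι → V) :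
    ∀ (j : ℕ) (c : ℝ) (α β : Alt V j), altInner b j (c • α) β = c * altInner b j α β
  | 0, _, _, _ => by simp [altInner]
  | k + 1, c, α, β => by
      change (k.factorial : ℝ)⁻¹ * ∑ I : Fin k → ι,
        (c * α.form (fun i => b (I i))) * _ = c * (_ * _)
      rw [mul_left_comm]
      simp only [mul_assoc, Finset.mul_sum]

theorem altInner_comm (b : ι → V) :
    ∀ (j : ℕ) (α β : Alt V j), altInner b j α β = altInner b j β α
  | 0, _, _ => rfl
  | k + 1, α, β => by simp only [altInner, mul_comm]

theorem altInner_self_nonneg (b : ι → V) : ∀ (j : ℕ) (α : Alt V j), 0 ≤ altInner b j α α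
  | 0, _ => le_rfl
  | _ + 1, _ => mul_nonneg (by positivity) (Finset.sum_nonneg fun _ _ => mul_self_nonneg _)

/-- `altInner` as a bilinear form. -/
def altBilin (b : ι → V) (j : ℕ) : Alt V j →ₗ[ℝ] Alt V j →ₗ[ℝ] ℝ :=
  LinearMap.mk₂ ℝ (altInner b j) (altInner_add_left b j) (altInner_smul_left b j)
    (fun α β ξ => by
      rw [altInner_comm, altInner_add_left, altInner_comm b j β, altInner_comm b j ξ])
    (fun c α β => by rw [altInner_comm, altInner_smul_left, altInner_comm b j β]; rfl)

theorem altBilin_apply (b : ι → V) (j : ℕ) (α β : Alt V j) :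
    altBilin b j α β = altInner b j α β := rfl

@[simp] theorem altInner_zero_left (b : ι → V) (j : ℕ) (β : Alt V j) :
    altInner b j 0 β = 0 := by simp [← altBilin_apply]

@[simp] theorem altInner_zero_right (b : ι → V) (j : ℕ) (β : Alt V j) :
    altInner b j β 0 = 0 := by simp [← altBilin_apply]

section FiniteDimensional

variable [FiniteDimensional ℝ V]

instance finiteDimensional_alt : ∀ j : ℕ, FiniteDimensional ℝ (Alt V j)
  | 0 => inferInstanceAs (FiniteDimensional ℝ PUnit)
  | k + 1 => by
      let toMultilinear : V [⋀^Fin k]→L[ℝ] ℝ →ₗ[ℝ] MultilinearMap ℝ (fun _ : Fin k => V) ℝ :=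
        { toFun := fun α => α.toMultilinearMap
          map_add' := fun _ _ => rfl
          map_smul' := fun _ _ => rfl }
      exact FiniteDimensional.of_injective toMultilinear fun α β h =>
        ContinuousAlternatingMap.ext fun v => DFunLike.congr_fun h v

theorem continuous_altInner {X : Type*} [TopologicalSpace X] (b : ι → V) (j : ℕ)
    {α β : X → Alt V j} (hα : Continuous α) (hβ : Continuous β) :
    Continuous fun x => altInner b j (α x) (β x) := by
  let B : Alt V j →L[ℝ] Alt V j →L[ℝ] ℝ :=
    (LinearMap.toContinuousLinearMap (𝕜 := ℝ) (E := Alt V j) (F' := ℝ)).toLinearMap.comp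
      (altBilin b j) |>.toContinuousLinearMap
  exact (B.continuous.comp hα).clm_apply hβ

theorem continuous_pullback {X : Type*} [TopologicalSpace X] (A : W →L[ℝ] V)
    (j : ℕ) {α : X → Alt V j} (hα : Continuous α) : Continuous fun x => pullback A j (α x) :=
  (pullback A j).continuous_of_finiteDimensional.comp hα

end FiniteDimensional

end Alt

section OrthonormalBasis

variable {V W : Type} [NormedAddCommGroup V] [InnerProductSpace ℝ V]
  [NormedAddCommGroup W] [InnerProductSpace ℝ W] {ι κ : Type} [Fintype ι] [Fintype κ]

theorem prod_norm_sq_eq_sum_prod_inner_sq (b : OrthonormalBasis ι ℝ V) {k : ℕ} (v : Fin k → V) :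
    ∏ i, ‖v i‖ ^ 2 = ∑ I : Fin k → ι, (∏ i, inner ℝ (b (I i)) (v i)) ^ 2 := by
  classical
  have parseval : ∀ i, ‖v i‖ ^ 2 = ∑ l, inner ℝ (b l) (v i) ^ 2 := fun i => by
    simp [← b.sum_sq_norm_inner_right (v i)]
  simp_rw [parseval, Finset.prod_univ_sum, Finset.prod_pow]
  simp

theorem alternating_apply_eq_sum (b : OrthonormalBasis ι ℝ V) {k : ℕ}
    (α : V [⋀^Fin k]→L[ℝ] ℝ) (v : Fin k → V) :
    α v = ∑ I : Fin k → ι, (∏ i, inner ℝ (b (I i)) (v i)) * α (fun i => b (I i)) := by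
  classical
  have expand : v = fun i => ∑ l, inner ℝ (b l) (v i) • b l :=
    funext fun i => (b.sum_repr' (v i)).symm
  conv_lhs => rw [expand]
  exact (α.toMultilinearMap.map_sum fun (i : Fin k) (l : ι) => inner ℝ (b l) (v i) • b l).trans
    (Finset.sum_congr rfl fun I _ =>
      α.toMultilinearMap.map_smul_univ (fun i => inner ℝ (b (I i)) (v i)) fun i => b (I i))

theorem sq_apply_le_altInner (b : OrthonormalBasis ι ℝ V) {k : ℕ}
    (α : V [⋀^Fin k]→L[ℝ] ℝ) (v : Fin k → V) :
    α v ^ 2 ≤ (∏ i, ‖v i‖ ^ 2) * (k.factorial * altInner b (k + 1) α α) :=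
  calc α v ^ 2 ≤ (∏ i, ‖v i‖ ^ 2) * ∑ I : Fin k → ι, α (fun i => b (I i)) ^ 2 := by
        rw [alternating_apply_eq_sum b α v, prod_norm_sq_eq_sum_prod_inner_sq b]
        exact Finset.sum_mul_sq_le_sq_mul_sq _ _ _
    _ = (∏ i, ‖v i‖ ^ 2) * (k.factorial * altInner b (k + 1) α α) := by
        simp only [altInner]
        rw [mul_inv_cancel_left₀ (by positivity)]
        simp only [sq]

theorem eq_zero_of_altInner_self (b : OrthonormalBasis ι ℝ V) :
    ∀ (j : ℕ) (α : Alt V j), altInner b j α α = 0 → α = 0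
  | 0, _, _ => rfl
  | k + 1, α, h => by
      refine ContinuousAlternatingMap.ext fun v => ?_
      have hle := sq_apply_le_altInner b α v
      rw [h, mul_zero, mul_zero] at hle
      exact (pow_eq_zero_iff two_ne_zero).1 (le_antisymm hle (sq_nonneg _))

theorem altInner_pullback_le (b : OrthonormalBasis ι ℝ V) (c : OrthonormalBasis κ ℝ W)
    (A : W →L[ℝ] V) (k : ℕ) (α : Alt V (k + 1)) :
    altInner c (k + 1) (pullback A (k + 1) α) (pullback A (k + 1) α) ≤
      Fintype.card κ ^ k * ‖A‖ ^ (2 * k) * altInner b (k + 1) α α := by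
  have h0 := altInner_self_nonneg b (k + 1) α
  have hterm : ∀ I : Fin k → κ, α.form (fun i => A (c (I i))) ^ 2 ≤
      ‖A‖ ^ (2 * k) * (k.factorial * altInner b (k + 1) α α) := fun I => by
    refine (sq_apply_le_altInner b α _).trans ?_
    gcongr
    calc ∏ i, ‖A (c (I i))‖ ^ 2 ≤ ∏ _i : Fin k, ‖A‖ ^ 2 := by
          gcongr with i
          simpa using A.le_opNorm (c (I i))
      _ = ‖A‖ ^ (2 * k) := by simp [pow_mul]
  calc altInner c (k + 1) (pullback A (k + 1) α) (pullback A (k + 1) α)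
      = (k.factorial : ℝ)⁻¹ * ∑ I : Fin k → κ, α.form (fun i => A (c (I i))) ^ 2 := by
        simp only [sq]; rfl
    _ ≤ (k.factorial : ℝ)⁻¹ * ∑ _I : Fin k → κ,
          ‖A‖ ^ (2 * k) * (k.factorial * altInner b (k + 1) α α) := by
        gcongr with I _; exact hterm I
    _ = Fintype.card κ ^ k * ‖A‖ ^ (2 * k) * altInner b (k + 1) α α := by
        simp only [Finset.sum_const, Finset.card_univ, Fintype.card_pi, Finset.prod_const,
          Fintype.card_fin, nsmul_eq_mul, Nat.cast_pow]
        field_simp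

end OrthonormalBasis

section Tangential

variable {V W : Type} [NormedAddCommGroup V] [InnerProductSpace ℝ V] [FiniteDimensional ℝ V]
  [NormedAddCommGroup W] [InnerProductSpace ℝ W] [FiniteDimensional ℝ W]

/-- The inner product of the tangential parts, along the subspace `D`, of two alternating forms;
it is the integrand of the boundary inner product of two tangential traces. -/
def tanInner (D : Submodule ℝ V) (j : ℕ) (α β : Alt V j) : ℝ :=
  altInner (stdOrthonormalBasis ℝ D) j (pullback D.subtypeL j α) (pullback D.subtypeL j β)

theorem tanInner_self_nonneg (D : Submodule ℝ V) (j : ℕ) (α : Alt V j) :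
    0 ≤ tanInner D j α α := altInner_self_nonneg _ _ _

theorem continuous_tanInner {X : Type*} [TopologicalSpace X] (D : Submodule ℝ V) (j : ℕ)
    {α β : X → Alt V j} (hα : Continuous α) (hβ : Continuous β) :
    Continuous fun x => tanInner D j (α x) (β x) :=
  continuous_altInner _ _ (continuous_pullback _ _ hα) (continuous_pullback _ _ hβ)

theorem pullback_subtypeL_eq_zero_of_tanInner_self {D : Submodule ℝ V} {j : ℕ} {α : Alt V j}
    (h : tanInner D j α α = 0) : pullback D.subtypeL j α = 0 :=
  eq_zero_of_altInner_self _ _ _ h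

theorem tanInner_pullback_le {D : Submodule ℝ V} {D' : Submodule ℝ W} {A : W →L[ℝ] V}
    (hA : ∀ x ∈ D', A x ∈ D) (k : ℕ) (α : Alt V (k + 1)) :
    tanInner D' (k + 1) (pullback A (k + 1) α) (pullback A (k + 1) α) ≤
      Module.finrank ℝ W ^ k * ‖A‖ ^ (2 * k) * tanInner D (k + 1) α α := by
  let A' : D' →L[ℝ] D := (A.comp D'.subtypeL).codRestrict D fun x => hA x x.2
  have hA' : ‖A'‖ ≤ ‖A‖ := A'.opNorm_le_bound (norm_nonneg _) fun x => A.le_opNorm x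
  have hdim : (Module.finrank ℝ D' : ℝ) ≤ Module.finrank ℝ W :=
    Nat.cast_le.2 (Submodule.finrank_le D')
  have h0 := tanInner_self_nonneg D (k + 1) α
  calc tanInner D' (k + 1) (pullback A (k + 1) α) (pullback A (k + 1) α)
      ≤ Fintype.card (Fin (Module.finrank ℝ D')) ^ k * ‖A'‖ ^ (2 * k) * tanInner D (k + 1) α α :=
        altInner_pullback_le (stdOrthonormalBasis ℝ D) (stdOrthonormalBasis ℝ D') A' k
          (pullback D.subtypeL (k + 1) α)
    _ ≤ Module.finrank ℝ W ^ k * ‖A‖ ^ (2 * k) * tanInner D (k + 1) α α := by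
        rw [Fintype.card_fin]
        gcongr

end Tangential

/-! ### Affine changes of variables -/

section Hausdorff

variable {X Y : Type*} [MetricSpace X] [MeasurableSpace X] [BorelSpace X]
  [MetricSpace Y] [MeasurableSpace Y] [BorelSpace Y] {L : NNReal}

theorem euclideanHausdorffMeasure_image_le {f : X → Y} (hf : LipschitzWith L f) (d : ℕ)
    (s : Set X) : μHE[d] (f '' s) ≤ (L : ENNReal) ^ d * μHE[d] s := by
  have h := hf.hausdorffMeasure_image_le (d := d) (by positivity) s
  rw [ENNReal.rpow_natCast] at h
  simp only [Measure.euclideanHausdorffMeasure_def, Measure.smul_apply, ENNReal.smul_def,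
    smul_eq_mul]
  rw [mul_left_comm]
  gcongr

theorem map_euclideanHausdorffMeasure_le {e : X ≃ₜ Y} (he : LipschitzWith L e.symm) (d : ℕ) :
    (μHE[d] : Measure X).map e ≤ (L ^ d : NNReal) • (μHE[d] : Measure Y) := by
  refine Measure.le_iff.2 fun s _ => ?_
  rw [e.measurableEmbedding.map_apply, ← e.symm_symm, ← e.symm.image_eq_preimage_symm,
    Measure.smul_apply, ENNReal.smul_def, smul_eq_mul, ENNReal.coe_pow]
  exact euclideanHausdorffMeasure_image_le he d s

theorem setIntegral_comp_homeomorph_le {e : X ≃ₜ Y} (he : LipschitzWith L e.symm) (d : ℕ)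
    (S : Set X) {g : Y → ℝ} (hg : ∀ y, 0 ≤ g y) (hi : IntegrableOn g (e '' S) μHE[d]) :
    ∫ x in S, g (e x) ∂μHE[d] ≤ L ^ d * ∫ y in e '' S, g y ∂μHE[d] := by
  calc ∫ x in S, g (e x) ∂μHE[d] = ∫ y in e '' S, g y ∂(Measure.map e μHE[d]) := by
        rw [e.measurableEmbedding.setIntegral_map, e.injective.preimage_image]
    _ ≤ ∫ y in e '' S, g y ∂((L ^ d : NNReal) • (μHE[d] : Measure Y)) := by
        refine integral_mono_measure
          (Measure.restrict_mono le_rfl (map_euclideanHausdorffMeasure_le he d))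
          (Filter.Eventually.of_forall hg) ?_
        rw [Measure.restrict_smul]
        exact hi.smul_measure_nnreal
    _ = L ^ d * ∫ y in e '' S, g y ∂μHE[d] := by
        rw [Measure.restrict_smul, integral_smul_nnreal_measure, NNReal.smul_def,
          NNReal.coe_pow, smul_eq_mul]

end Hausdorff

section AffineEquiv

variable {V W : Type*} [NormedAddCommGroup V] [NormedSpace ℝ V]
  [NormedAddCommGroup W] [NormedSpace ℝ W]

theorem lipschitzWith_continuousAffineMap (φ : V →ᴬ[ℝ] W) : LipschitzWith ‖φ.contLinear‖₊ φ :=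
  LipschitzWith.of_dist_le_mul fun x y => by
    rw [dist_eq_norm, dist_eq_norm, ← vsub_eq_sub (φ x), ← φ.contLinear_map_vsub, vsub_eq_sub]
    exact φ.contLinear.le_opNorm (x - y)

/-- The linear part of an affine equivalence, as a continuous linear map; its norm and the norm
of its inverse govern the scaling of forms under pullback. -/
abbrev linPart (φ : V ≃ᴬ[ℝ] W) : V →L[ℝ] W := φ.toContinuousAffineMap.contLinear

theorem linPart_symm_apply_linPart (φ : V ≃ᴬ[ℝ] W) (v : V) :
    linPart φ.symm (linPart φ v) = v :=
  φ.toAffineEquiv.linear.symm_apply_apply v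

end AffineEquiv

variable {n : ℕ}

theorem altInner_single (j : ℕ) (α β : Alt (Euc n) j) :
    altInner (fun i : Fin n => EuclideanSpace.single i (1 : ℝ)) j α β =
      altInner (EuclideanSpace.basisFun (Fin n) ℝ) j α β := by
  congr 1
  funext i
  simp

/-- The pullback of a differential form by a continuous affine map. -/
def pullForm (φ : Euc n →ᴬ[ℝ] Euc n) (j : ℕ) : Form n j →ₗ[ℝ] Form n j :=
  LinearMap.pi fun x => (pullback φ.contLinear j).comp (LinearMap.proj (φ x))

theorem continuous_pullForm (φ : Euc n →ᴬ[ℝ] Euc n) (j : ℕ) {τ : Form n j}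
    (hτ : Continuous τ) : Continuous (pullForm φ j τ) :=
  continuous_pullback _ _ (Continuous.comp hτ φ.continuous)

theorem pullForm_pullForm_symm (φ : Euc n ≃ᴬ[ℝ] Euc n) : ∀ (j : ℕ) (τ : Form n j),
    pullForm φ j (pullForm φ.symm j τ) = τ
  | 0, _ => rfl
  | k + 1, τ => by
      funext x
      refine ContinuousAlternatingMap.ext fun v => ?_
      change (τ (φ.symm (φ x))).form (fun i => linPart φ.symm (linPart φ (v i))) = (τ x).form v
      simp only [linPart_symm_apply_linPart, φ.symm_apply_apply]

theorem ip_eq_setIntegral_basisFun {j : ℕ} (U : Set (Euc n)) (α β : Form n j) :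
    ip U α β = ∫ x in U, altInner (EuclideanSpace.basisFun (Fin n) ℝ) j (α x) (β x) := by
  simp only [ip, altInner_single]

theorem setIntegral_comp_continuousAffineEquiv_le (φ : Euc n ≃ᴬ[ℝ] Euc n) (d : ℕ)
    (S : Set (Euc n)) {g : Euc n → ℝ} (hg : ∀ x, 0 ≤ g x)
    (hi : IntegrableOn g (φ '' S) μHE[d]) :
    ∫ x in S, g (φ x) ∂μHE[d] ≤
      ‖linPart φ.symm‖ ^ d * ∫ x in φ '' S, g x ∂μHE[d] :=
  setIntegral_comp_homeomorph_le (e := φ.toHomeomorph)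
    (lipschitzWith_continuousAffineMap φ.symm.toContinuousAffineMap) d S hg hi

theorem ip_pullForm_le (φ : Euc n ≃ᴬ[ℝ] Euc n) {S : Set (Euc n)} (hS : IsCompact S)
    (k : ℕ) {τ : Form n (k + 1)} (hτ : Continuous τ) :
    ip S (pullForm φ (k + 1) τ) (pullForm φ (k + 1) τ) ≤
      n ^ k * ‖linPart φ‖ ^ (2 * k) *
        (‖linPart φ.symm‖ ^ n * ip (φ '' S) τ τ) := by
  set c : ℝ := n ^ k * ‖linPart φ‖ ^ (2 * k)
  set B := EuclideanSpace.basisFun (Fin n) ℝ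
  let g : Euc n → ℝ := fun x => altInner B (k + 1) (τ x) (τ x)
  have hg : Continuous g := continuous_altInner _ _ hτ hτ
  have hφτ : Continuous (pullForm φ (k + 1) τ) := continuous_pullForm _ (k + 1) hτ
  have hpoint : ∀ x, altInner B (k + 1) (pullForm φ (k + 1) τ x) (pullForm φ (k + 1) τ x) ≤
      c * g (φ x) := fun x => by
    have h := altInner_pullback_le B B (linPart φ) k (τ (φ x))
    rwa [Fintype.card_fin] at h
  rw [ip_eq_setIntegral_basisFun, ip_eq_setIntegral_basisFun,
    ← EuclideanSpace.euclideanHausdorffMeasure_eq_volume]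
  have : IsFiniteMeasureOnCompacts (μHE[n] : Measure (Euc n)) := by
    rw [EuclideanSpace.euclideanHausdorffMeasure_eq_volume]; infer_instance
  calc ∫ x in S, altInner B (k + 1) (pullForm φ (k + 1) τ x) (pullForm φ (k + 1) τ x) ∂μHE[n]
      ≤ ∫ x in S, c * g (φ x) ∂μHE[n] := integral_mono
        ((continuous_altInner _ _ hφτ hφτ).continuousOn.integrableOn_compact hS)
        ((continuous_const.mul (hg.comp φ.continuous)).continuousOn.integrableOn_compact hS)
        hpoint
    _ = c * ∫ x in S, g (φ x) ∂μHE[n] := integral_const_mul _ _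
    _ ≤ c * (‖linPart φ.symm‖ ^ n * ∫ x in φ '' S, g x ∂μHE[n]) := by
        gcongr
        exact setIntegral_comp_continuousAffineEquiv_le φ n S (fun x => altInner_self_nonneg _ _ _)
          (hg.continuousOn.integrableOn_compact (hS.image φ.continuous))

/-! ### Simplices -/

section ConvexHull

variable {E : Type*} [NormedAddCommGroup E] [InnerProductSpace ℝ E] {P : Set E}

/-- The isometric parametrization of the affine span of `P ∋ p` by `vectorSpan ℝ P`, sending `0`
to `p`. It turns Hausdorff measure on the affine span into Lebesgue measure. -/
def spanParam (P : Set E) (p : E) : vectorSpan ℝ P →ᵃⁱ[ℝ] E :=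
  (AffineIsometryEquiv.vaddConst ℝ p).toAffineIsometry.comp
    (vectorSpan ℝ P).subtypeₗᵢ.toAffineIsometry

theorem convexHull_subset_range_spanParam {p : E} (hp : p ∈ P) :
    convexHull ℝ P ⊆ Set.range (spanParam P p) := fun x hx => by
  have hx' : x ∈ affineSpan ℝ P := convexHull_subset_affineSpan P hx
  have := AffineSubspace.vsub_mem_direction hx' (mem_affineSpan ℝ hp)
  rw [direction_affineSpan] at this
  exact ⟨⟨x - p, this⟩, sub_add_cancel x p⟩

theorem isCompact_preimage_spanParam [FiniteDimensional ℝ E] (hc : IsCompact (convexHull ℝ P))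
    (p : E) : IsCompact (spanParam P p ⁻¹' convexHull ℝ P) :=
  (spanParam P p).isometry.isClosedEmbedding.isCompact_preimage hc

theorem convex_preimage_spanParam (p : E) : Convex ℝ (spanParam P p ⁻¹' convexHull ℝ P) :=
  (convex_convexHull ℝ P).affine_preimage (spanParam P p).toAffineMap

theorem interior_preimage_spanParam_nonempty [FiniteDimensional ℝ E] {p : E} (hp : p ∈ P) :
    (interior (spanParam P p ⁻¹' convexHull ℝ P)).Nonempty := by
  rw [(convex_preimage_spanParam p).interior_nonempty_iff_affineSpan_eq_top]
  have hP : P ⊆ Set.range (spanParam P p) :=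
    (subset_convexHull ℝ P).trans (convexHull_subset_range_spanParam hp)
  have hspan : vectorSpan ℝ (spanParam P p ⁻¹' P) = ⊤ := by
    apply Submodule.map_injective_of_injective (vectorSpan ℝ P).injective_subtype
    have h := AffineMap.map_vectorSpan (spanParam P p).toAffineMap (s := spanParam P p ⁻¹' P)
    rw [AffineIsometry.coe_toAffineMap, Set.image_preimage_eq_of_subset hP] at h
    rw [Submodule.map_top, Submodule.range_subtype]
    exact h
  obtain ⟨y, hy⟩ := hP hp
  have hne : (spanParam P p ⁻¹' P).Nonempty := ⟨y, by rwa [Set.mem_preimage, hy]⟩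
  rw [← top_le_iff,
    ← (AffineSubspace.affineSpan_eq_top_iff_vectorSpan_eq_top_of_nonempty ℝ _ _ hne).2 hspan]
  exact affineSpan_mono ℝ (Set.preimage_mono (subset_convexHull ℝ P))

variable [FiniteDimensional ℝ E] [MeasurableSpace E] [BorelSpace E]

theorem restrict_convexHull_eq_map {p : E} (hp : p ∈ P) (hc : IsCompact (convexHull ℝ P)) :
    (μHE[Module.finrank ℝ (vectorSpan ℝ P)] : Measure E).restrict (convexHull ℝ P) =
      ((volume : Measure (vectorSpan ℝ P)).restrict
        (spanParam P p ⁻¹' convexHull ℝ P)).map (spanParam P p) := by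
  have hφ := (spanParam P p).isometry
  rw [← InnerProductSpace.euclideanHausdorffMeasure_eq_volume,
    ← Measure.restrict_map hφ.continuous.measurable hc.isClosed.measurableSet,
    hφ.map_euclideanHausdorffMeasure, Measure.restrict_restrict hc.isClosed.measurableSet,
    Set.inter_eq_left.2 (convexHull_subset_range_spanParam hp)]

theorem euclideanHausdorffMeasure_convexHull_lt_top (hP : P.Finite) :
    (μHE[Module.finrank ℝ (vectorSpan ℝ P)] : Measure E) (convexHull ℝ P) < ⊤ := by
  rcases P.eq_empty_or_nonempty with rfl | ⟨p, hp⟩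
  · simp
  have hc := hP.isCompact_convexHull ℝ
  rw [← Measure.restrict_apply_univ, restrict_convexHull_eq_map hp hc,
    Measure.map_apply (spanParam P p).isometry.continuous.measurable MeasurableSet.univ,
    Set.preimage_univ, Measure.restrict_apply_univ]
  exact (isCompact_preimage_spanParam hc p).measure_lt_top

theorem integrableOn_convexHull (hP : P.Finite) {g : E → ℝ} (hg : Continuous g) :
    IntegrableOn g (convexHull ℝ P) μHE[Module.finrank ℝ (vectorSpan ℝ P)] := by
  have hc := hP.isCompact_convexHull ℝ
  obtain ⟨M, hM⟩ := hc.exists_bound_of_continuousOn hg.continuousOn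
  exact Measure.integrableOn_of_bounded (M := M)
    (euclideanHausdorffMeasure_convexHull_lt_top hP).ne hg.aestronglyMeasurable
    ((ae_restrict_iff' hc.isClosed.measurableSet).2 (Filter.Eventually.of_forall hM))

theorem eqOn_zero_of_setIntegral_convexHull_eq_zero (hP : P.Finite) {g : E → ℝ}
    (hg : Continuous g) (h0 : ∀ x, 0 ≤ g x)
    (h : ∫ x in convexHull ℝ P, g x ∂μHE[Module.finrank ℝ (vectorSpan ℝ P)] = 0) :
    ∀ x ∈ convexHull ℝ P, g x = 0 := by
  intro x hx
  obtain ⟨p, hp⟩ := convexHull_nonempty_iff.1 ⟨x, hx⟩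
  have hc := hP.isCompact_convexHull ℝ
  have hφ := (spanParam P p).isometry
  have hgφ : Continuous (g ∘ spanParam P p) := hg.comp hφ.continuous
  set Q := spanParam P p ⁻¹' convexHull ℝ P
  rw [restrict_convexHull_eq_map hp hc,
    hφ.isClosedEmbedding.measurableEmbedding.integral_map,
    integral_eq_zero_iff_of_nonneg (fun y => h0 _)
      (hgφ.continuousOn.integrableOn_compact (isCompact_preimage_spanParam hc p))] at h
  have hint : Set.EqOn (g ∘ spanParam P p) (fun _ => 0) (interior Q) :=
    Measure.eqOn_open_of_ae_eq (μ := volume)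
      (ae_restrict_of_ae_restrict_of_subset interior_subset h) isOpen_interior
      hgφ.continuousOn continuousOn_const
  have hcl := hint.closure hgφ continuous_const
  rw [(convex_preimage_spanParam p).closure_interior_eq_closure_of_nonempty_interior
    (interior_preimage_spanParam_nonempty hp)] at hcl
  obtain ⟨y, rfl⟩ := convexHull_subset_range_spanParam hp hx
  exact hcl (subset_closure hx)

end ConvexHull

section AffineBasis

theorem exists_affineEquiv_forall_apply_eq {k ι V V' P P' : Type*} [Ring k]
    [AddCommGroup V] [Module k V] [AddTorsor V P] [AddCommGroup V'] [Module k V']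
    [AddTorsor V' P'] (B : AffineBasis ι k P) (B' : AffineBasis ι k P') :
    ∃ φ : P ≃ᵃ[k] P', ∀ i, φ (B i) = B' i := by
  obtain ⟨i⟩ := B.nonempty
  let A := (B.basisOf i).equiv (B'.basisOf i) (Equiv.refl _)
  refine ⟨(AffineEquiv.vaddConst k (B i)).symm.trans
    (A.toAffineEquiv.trans (AffineEquiv.vaddConst k (B' i))), fun j => ?_⟩
  have hA : A (B j -ᵥ B i) = B' j -ᵥ B' i := by
    rcases eq_or_ne j i with rfl | hj
    · simp
    · simpa using (B.basisOf i).equiv_apply ⟨j, hj⟩ (B'.basisOf i) (Equiv.refl _)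
  simp [hA]

theorem norm_contLinear_le_of_ball_subset {V W : Type*} [NormedAddCommGroup V] [NormedSpace ℝ V]
    [NormedAddCommGroup W] [NormedSpace ℝ W] (φ : V →ᴬ[ℝ] W) {S : Set V} {S' : Set W}
    (hS' : Bornology.IsBounded S') (h : Set.MapsTo φ S S') {c : V} {ρ : ℝ} (hρ : 0 < ρ)
    (hb : Metric.ball c ρ ⊆ S) : ‖φ.contLinear‖ ≤ 2 * Metric.diam S' / ρ := by
  have : 0 ≤ Metric.diam S' := Metric.diam_nonneg
  refine ContinuousLinearMap.opNorm_le_of_unit_norm (by positivity) fun x hx => ?_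
  have hmem : (ρ / 2) • x + c ∈ S := hb (by
    rw [mem_ball_iff_norm, add_sub_cancel_right, norm_smul, hx,
      Real.norm_of_nonneg (by positivity)]
    linarith)
  have hdist := Metric.dist_le_diam_of_mem hS' (h hmem) (h (hb (Metric.mem_ball_self hρ)))
  rw [dist_eq_norm, ← vsub_eq_sub, ← φ.contLinear_map_vsub, vsub_eq_sub, add_sub_cancel_right,
    map_smul, norm_smul, Real.norm_of_nonneg (by positivity)] at hdist
  rw [le_div_iff₀ hρ]
  linarith

end AffineBasis

/-- `K` is the vertex set of a nondegenerate `n`-simplex. -/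
def IsSimplex (K : Finset (Euc n)) : Prop :=
  AffineIndependent ℝ ((↑) : K → Euc n) ∧ K.card = n + 1

theorem finite_sdiff_singleton (K : Finset (Euc n)) (v : Euc n) :
    ((K : Set (Euc n)) \ {v}).Finite :=
  K.finite_toSet.sdiff

theorem isCompact_cell (K : Finset (Euc n)) : IsCompact (cell K) :=
  K.finite_toSet.isCompact_convexHull ℝ

theorem convex_cell (K : Finset (Euc n)) : Convex ℝ (cell K) := convex_convexHull ℝ _

theorem isCompact_facet (K : Finset (Euc n)) (v : {v // v ∈ K}) : IsCompact (facet K v) :=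
  (finite_sdiff_singleton K v).isCompact_convexHull ℝ

namespace IsSimplex

variable {K K' : Finset (Euc n)}

theorem finrank_facetDir (hK : IsSimplex K) (hn : 0 < n) (v : {v // v ∈ K}) :
    Module.finrank ℝ (facetDir K v) = n - 1 := by
  classical
  have h := hK.1.finrank_vectorSpan_image_finset (s := Finset.univ.erase v) (n := n - 1)
    (by rw [Finset.card_erase_of_mem (Finset.mem_univ _), Finset.card_univ, Fintype.card_coe,
          hK.2]; lia)
  have hcoe : (K : Set (Euc n)) \ {v.1} =
      ((Finset.univ.erase v).image Subtype.val : Finset (Euc n)) := by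
    ext x
    simp [and_comm]
  rw [facetDir, hcoe]
  exact h

theorem affineSpan_eq_top (hK : IsSimplex K) : affineSpan ℝ (K : Set (Euc n)) = ⊤ := by
  simpa using hK.1.affineSpan_eq_top_iff_card_eq_finrank_add_one.2
    (by rw [Fintype.card_coe, hK.2, finrank_euclideanSpace_fin])

theorem interior_cell_nonempty (hK : IsSimplex K) : (interior (cell K)).Nonempty :=
  interior_convexHull_nonempty_iff_affineSpan_eq_top.2 hK.affineSpan_eq_top

theorem cellDiam_pos (hK : IsSimplex K) (hn : 0 < n) : 0 < cellDiam K := by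
  obtain ⟨a, ha, b, hb, hab⟩ := Finset.one_lt_card.1 (show 1 < K.card by rw [hK.2]; lia)
  exact Metric.diam_pos
    ⟨a, subset_convexHull ℝ _ ha, b, subset_convexHull ℝ _ hb, hab⟩ (isCompact_cell K).isBounded

theorem exists_continuousAffineEquiv_image_eq (hK : IsSimplex K) (hK' : IsSimplex K') :
    ∃ φ : Euc n ≃ᴬ[ℝ] Euc n, φ '' (K : Set (Euc n)) = K' := by
  let e : K ≃ K' := Finset.equivOfCardEq (hK.2.trans hK'.2.symm)
  obtain ⟨φ, hφ⟩ := exists_affineEquiv_forall_apply_eq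
    (⟨(↑), hK.1, by simpa using hK.affineSpan_eq_top⟩ : AffineBasis K ℝ (Euc n))
    ((⟨(↑), hK'.1, by simpa using hK'.affineSpan_eq_top⟩ : AffineBasis K' ℝ (Euc n)).reindex
      e.symm)
  replace hφ : ∀ i : K, φ i = e i := hφ
  refine ⟨φ.toContinuousAffineEquiv, ?_⟩
  calc φ '' (K : Set (Euc n)) = Set.range (fun i : K => φ i) := by
        rw [Set.range_comp', Subtype.range_coe_subtype]; rfl
    _ = Set.range (fun i : K => (e i : Euc n)) := by simp only [hφ]
    _ = K' := by rw [Set.range_comp', e.surjective.range_eq]; simp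

end IsSimplex

section CellImage

variable {K K' : Finset (Euc n)} (φ : Euc n ≃ᴬ[ℝ] Euc n)

theorem image_cell (h : φ '' (K : Set (Euc n)) = K') : φ '' cell K = cell K' := by
  rw [cell, cell, ← h]
  exact AffineMap.image_convexHull (φ : Euc n →ᵃ[ℝ] Euc n) _

theorem exists_equiv_facets (h : φ '' (K : Set (Euc n)) = K') :
    ∃ e : {v // v ∈ K} ≃ {v // v ∈ K'}, ∀ v, φ '' facet K v = facet K' (e v) ∧
      (facetDir K v).map (linPart φ : Euc n →ₗ[ℝ] Euc n) = facetDir K' (e v) := by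
  have hmem : ∀ v, v ∈ K ↔ φ v ∈ K' := fun v => by
    rw [← Finset.mem_coe, ← Finset.mem_coe, ← h, φ.injective.mem_set_image]
  refine ⟨φ.toEquiv.subtypeEquiv hmem, fun v => ?_⟩
  have hsdiff : φ '' ((K : Set (Euc n)) \ {v.1}) = (K' : Set (Euc n)) \ {φ v.1} := by
    rw [Set.image_sdiff φ.injective, h, Set.image_singleton]
  constructor
  · exact (AffineMap.image_convexHull (φ : Euc n →ᵃ[ℝ] Euc n) _).trans
      (congrArg (convexHull ℝ) hsdiff)
  · exact (AffineMap.map_vectorSpan (φ : Euc n →ᵃ[ℝ] Euc n)).trans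
      (congrArg (vectorSpan ℝ) hsdiff)

end CellImage

/-! ### Polynomial forms -/

section TotalDegree

variable {R σ τ : Type*} [CommSemiring R]

theorem totalDegree_bind₁_le {Q : σ → MvPolynomial τ R} (hQ : ∀ i, (Q i).totalDegree ≤ 1)
    (P : MvPolynomial σ R) : (MvPolynomial.bind₁ Q P).totalDegree ≤ P.totalDegree := by
  rw [MvPolynomial.bind₁, MvPolynomial.aeval_def, MvPolynomial.eval₂_eq,
    MvPolynomial.algebraMap_eq]
  refine MvPolynomial.totalDegree_finsetSum_le fun d hd => ?_
  calc (MvPolynomial.C (P.coeff d) * ∏ i ∈ d.support, Q i ^ d i).totalDegree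
      ≤ (∏ i ∈ d.support, Q i ^ d i).totalDegree :=
        (MvPolynomial.totalDegree_mul _ _).trans_eq (by simp)
    _ ≤ ∑ i ∈ d.support, (Q i ^ d i).totalDegree := MvPolynomial.totalDegree_finsetProd _ _
    _ ≤ ∑ i ∈ d.support, d i := Finset.sum_le_sum fun i _ =>
        (MvPolynomial.totalDegree_pow _ _).trans
          ((Nat.mul_le_mul_left _ (hQ i)).trans_eq (mul_one _))
    _ ≤ P.totalDegree := MvPolynomial.le_totalDegree hd

theorem totalDegree_pderiv_le (i : σ) {r : ℕ} {P : MvPolynomial σ R}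
    (hP : P.totalDegree ≤ r + 1) : (MvPolynomial.pderiv i P).totalDegree ≤ r := by
  classical
  rw [P.as_sum, map_sum]
  refine MvPolynomial.totalDegree_finsetSum_le fun d hd => ?_
  rw [MvPolynomial.pderiv_monomial]
  by_cases hi : d i = 0
  · simp [hi]
  refine (MvPolynomial.totalDegree_monomial_le _ _).trans ?_
  have hd_le : d.degree ≤ r + 1 := (MvPolynomial.le_totalDegree hd).trans hP
  have hd_eq : (d - Finsupp.single i 1).degree + 1 = d.degree := by
    conv_rhs => rw [← tsub_add_cancel_of_le (show Finsupp.single i 1 ≤ d by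
      simpa using Nat.one_le_iff_ne_zero.2 hi), map_add, Finsupp.degree_single]
  change (d - Finsupp.single i 1).degree ≤ r
  omega

end TotalDegree

theorem eq_sum_single (x : Euc n) : x = ∑ l, x l • EuclideanSpace.single l (1 : ℝ) := by
  simpa using ((EuclideanSpace.basisFun (Fin n) ℝ).sum_repr x).symm

theorem hasFDerivAt_eval (P : MvPolynomial (Fin n) ℝ) (x : Euc n) :
    HasFDerivAt (fun y : Euc n => MvPolynomial.eval (fun i => y i) P)
      (∑ i, MvPolynomial.eval (fun i => x i) (MvPolynomial.pderiv i P) •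
        (EuclideanSpace.proj i : Euc n →L[ℝ] ℝ)) x := by
  induction P using MvPolynomial.induction_on with
  | C a => simpa using hasFDerivAt_const a x
  | add p q hp hq =>
      simp only [map_add, add_smul, Finset.sum_add_distrib]
      exact hp.add hq
  | mul_X p i hp =>
      have hX : HasFDerivAt (fun y : Euc n => y i) (EuclideanSpace.proj i : Euc n →L[ℝ] ℝ) x :=
        (EuclideanSpace.proj i : Euc n →L[ℝ] ℝ).hasFDerivAt
      simp only [map_mul, MvPolynomial.eval_X]
      refine (hp.mul hX).congr_fderiv ?_
      simp only [Derivation.leibniz, smul_eq_mul, map_add, map_mul, MvPolynomial.eval_X,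
        add_smul, Finset.sum_add_distrib, Finset.smul_sum, mul_smul, MvPolynomial.pderiv_X]
      congr 1
      rw [Finset.sum_eq_single i]
      · simp
      · intro j _ hj
        simp [hj.symm]
      · simp

namespace IsPoly

variable {r : ℕ} {g : Euc n → ℝ}

theorem mono {s : ℕ} (h : r ≤ s) (hg : IsPoly r g) : IsPoly s g := by
  obtain ⟨P, hP, hgP⟩ := hg
  exact ⟨P, hP.trans h, hgP⟩

theorem const_mul (hg : IsPoly r g) (c : ℝ) : IsPoly r fun x => c * g x := by
  obtain ⟨P, hP, hgP⟩ := hg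
  exact ⟨c • P, (MvPolynomial.totalDegree_smul_le c P).trans hP, fun x => by simp [hgP]⟩

theorem coord_mul (hg : IsPoly r g) (i : Fin n) : IsPoly (r + 1) fun x => x i * g x := by
  obtain ⟨P, hP, hgP⟩ := hg
  refine ⟨MvPolynomial.X i * P, (MvPolynomial.totalDegree_mul _ _).trans ?_,
    fun x => by simp [hgP]⟩
  rw [MvPolynomial.totalDegree_X]
  omega

theorem sum {ι : Type*} (s : Finset ι) {g : ι → Euc n → ℝ} (hg : ∀ i, IsPoly r (g i)) :
    IsPoly r fun x => ∑ i ∈ s, g i x := by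
  choose P hP hgP using hg
  exact ⟨∑ i ∈ s, P i, MvPolynomial.totalDegree_finsetSum_le fun i _ => hP i,
    fun x => by simp [hgP]⟩

theorem contDiff (hg : IsPoly r g) : ContDiff ℝ ∞ g := by
  obtain ⟨P, -, hgP⟩ := hg
  rw [show g = _ from funext hgP]
  clear hgP
  induction P using MvPolynomial.induction_on with
  | C a => simpa using contDiff_const
  | add p q hp hq => simpa using hp.add hq
  | mul_X p i hp =>
      simp only [map_mul, MvPolynomial.eval_X]
      exact hp.mul (EuclideanSpace.proj i : Euc n →L[ℝ] ℝ).contDiff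

theorem comp_affineMap {m : ℕ} (hg : IsPoly r g) (φ : Euc m →ᵃ[ℝ] Euc n) :
    IsPoly r (g ∘ φ) := by
  obtain ⟨P, hP, hgP⟩ := hg
  let Q : Fin n → MvPolynomial (Fin m) ℝ := fun i =>
    ∑ l, MvPolynomial.C (φ.linear (EuclideanSpace.single l 1) i) * MvPolynomial.X l +
      MvPolynomial.C (φ 0 i)
  have hQ : ∀ i, (Q i).totalDegree ≤ 1 := fun i => by
    refine (MvPolynomial.totalDegree_add _ _).trans (max_le ?_ (by simp))
    refine MvPolynomial.totalDegree_finsetSum_le fun l _ => ?_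
    exact (MvPolynomial.totalDegree_mul _ _).trans (by simp)
  have hφ : ∀ x i, φ x i = MvPolynomial.eval (fun l => x l) (Q i) := fun x i => by
    rw [congrFun φ.decomp x, Pi.add_apply]
    conv_lhs => rw [eq_sum_single x]
    simp [Q, mul_comm]
  refine ⟨MvPolynomial.bind₁ Q P, (totalDegree_bind₁_le hQ P).trans hP, fun x => ?_⟩
  calc g (φ x) = MvPolynomial.eval (fun i => MvPolynomial.eval (fun l => x l) (Q i)) P := by
        simp only [hgP, hφ]
    _ = MvPolynomial.eval (fun l => x l) (MvPolynomial.bind₁ Q P) :=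
        (MvPolynomial.eval₂Hom_bind₁ (RingHom.id ℝ) (fun l => x l) Q P).symm

theorem fderiv_apply (hg : IsPoly (r + 1) g) (e : Euc n) : IsPoly r fun x => fderiv ℝ g x e := by
  obtain ⟨P, hP, hgP⟩ := hg
  have hderiv : (fun x => fderiv ℝ g x e) = fun x => ∑ i, e i *
      MvPolynomial.eval (fun i => x i) (MvPolynomial.pderiv i P) := by
    funext x
    rw [show g = _ from funext hgP, (hasFDerivAt_eval P x).fderiv]
    simp [mul_comm]
  rw [hderiv]
  exact IsPoly.sum _ fun i => IsPoly.const_mul ⟨_, totalDegree_pderiv_le i hP, fun _ => rfl⟩ _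

end IsPoly

section PolyForms

variable {r j : ℕ}

theorem form_eq_sum (v : Form n j) : v = fun x =>
    ∑ i, (Module.finBasis ℝ (Alt (Euc n) j)).coord i (v x) • Module.finBasis ℝ (Alt (Euc n) j) i :=
  funext fun x => ((Module.finBasis ℝ (Alt (Euc n) j)).sum_repr (v x)).symm

theorem contDiff_of_mem_polyForms {v : Form n j} (hv : v ∈ polyForms n r j) :
    ContDiff ℝ ∞ v := by
  rw [form_eq_sum v]
  exact ContDiff.sum fun i _ => (hv _).contDiff.smul contDiff_const

theorem differentiable_of_mem_polyForms {v : Form n j} (hv : v ∈ polyForms n r j) :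
    Differentiable ℝ v :=
  (contDiff_of_mem_polyForms hv).differentiable (by simp)

theorem polyForms_mono {s : ℕ} (h : r ≤ s) (j : ℕ) : polyForms n r j ≤ polyForms n s j :=
  fun _ hv ℓ => (hv ℓ).mono h

instance finiteDimensional_polyForms (r j : ℕ) : FiniteDimensional ℝ (polyForms n r j) := by
  let b := Module.finBasis ℝ (Alt (Euc n) j)
  let ofCoeffs : (Fin (Module.finrank ℝ (Alt (Euc n) j)) →
      MvPolynomial.restrictTotalDegree (Fin n) ℝ r) →ₗ[ℝ] Form n j :=
    { toFun := fun P x => ∑ i, MvPolynomial.eval (fun l => x l) (P i : MvPolynomial (Fin n) ℝ) • b i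
      map_add' := fun P Q => by
        funext x
        simp [add_smul, Finset.sum_add_distrib]
      map_smul' := fun c P => by
        funext x
        simp [mul_smul, Finset.smul_sum] }
  have hrange : polyForms n r j ≤ LinearMap.range ofCoeffs := fun v hv => by
    choose P hP hvP using fun i => hv (b.coord i)
    refine ⟨fun i => ⟨P i, (MvPolynomial.mem_restrictTotalDegree _ _ _).2 (hP i)⟩, ?_⟩
    rw [form_eq_sum v]
    funext x
    change ∑ i, MvPolynomial.eval (fun l => x l) (P i) • b i = ∑ i, b.coord i (v x) • b i
    simp only [hvP]
  exact Submodule.finiteDimensional_of_le hrange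

theorem pullForm_mem_polyForms (φ : Euc n →ᴬ[ℝ] Euc n) {v : Form n j}
    (hv : v ∈ polyForms n r j) : pullForm φ j v ∈ polyForms n r j :=
  fun ℓ => (hv (ℓ.comp (pullback φ.contLinear j))).comp_affineMap φ.toAffineMap

/-- The interior product as a linear map of the contracted vector. -/
def contractLeft (α : Alt (Euc n) (j + 1)) : Euc n →ₗ[ℝ] Alt (Euc n) j :=
  match j, α with
  | 0, _ => 0
  | _ + 1, α => (ContinuousAlternatingMap.curryLeft α.form).toLinearMap

theorem contractLeft_apply (α : Alt (Euc n) (j + 1)) (x : Euc n) :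
    contractLeft α x = contract x j α := by
  cases j <;> rfl

theorem koszul_mem_polyForms {v : Form n (j + 1)} (hv : v ∈ polyForms n r (j + 1)) :
    koszul n j v ∈ polyForms n (r + 1) j := fun ℓ => by
  have hcoord : (fun x => ℓ (koszul n j v x)) = fun x =>
      ∑ i, x i * (ℓ.comp (contract (EuclideanSpace.single i (1 : ℝ)) j)) (v x) := by
    funext x
    calc ℓ (contract x j (v x))
        = ℓ (contractLeft (v x) (∑ i, x i • EuclideanSpace.single i (1 : ℝ))) := by
          rw [← eq_sum_single, contractLeft_apply]
      _ = ∑ i, x i * (ℓ.comp (contract (EuclideanSpace.single i (1 : ℝ)) j)) (v x) := by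
          simp only [map_sum, map_smul, smul_eq_mul, contractLeft_apply, LinearMap.comp_apply]
  rw [hcoord]
  exact IsPoly.sum _ fun i => (hv _).coord_mul i

theorem trimmedForms_le (r j : ℕ) : trimmedForms n r j ≤ polyForms n (r + 1) j :=
  sup_le (polyForms_mono (Nat.le_succ r) j)
    (Submodule.map_le_iff_le_comap.2 fun _ hv => koszul_mem_polyForms hv)

theorem pullback_contract (A : Euc n →L[ℝ] Euc n) (x : Euc n) :
    ∀ (j : ℕ) (α : Alt (Euc n) (j + 1)),
      pullback A j (contract (A x) j α) = contract x j (pullback A (j + 1) α)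
  | 0, _ => rfl
  | k + 1, α => by
      refine ContinuousAlternatingMap.ext fun v => ?_
      change α.form (Matrix.vecCons (A x) fun i => A (v i)) =
        α.form fun i => A (Matrix.vecCons x v i)
      congr 1
      exact funext fun i => Fin.cases rfl (fun _ => rfl) i

theorem pullForm_koszul (φ : Euc n →ᴬ[ℝ] Euc n) (u : Form n (j + 1)) :
    pullForm φ j (koszul n j u) = koszul n j (pullForm φ (j + 1) u) +
      pullForm φ j fun x => contract (φ 0) j (u x) := by
  funext x
  have hφ : φ x = φ.contLinear x + φ 0 := congrFun (AffineMap.decomp φ.toAffineMap) x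
  change pullback φ.contLinear j (contract (φ x) j (u (φ x))) =
    contract x j (pullback φ.contLinear (j + 1) (u (φ x))) +
      pullback φ.contLinear j (contract (φ 0) j (u (φ x)))
  rw [← pullback_contract, ← map_add, ← contractLeft_apply, ← contractLeft_apply,
    ← contractLeft_apply, ← map_add, ← hφ]

theorem pullForm_mem_trimmedForms (φ : Euc n →ᴬ[ℝ] Euc n) {v : Form n j}
    (hv : v ∈ trimmedForms n r j) : pullForm φ j v ∈ trimmedForms n r j := by
  obtain ⟨w, hw, _, ⟨u, hu, rfl⟩, rfl⟩ := Submodule.mem_sup.1 hv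
  have hcontract : (fun x => contract (φ 0) j (u x)) ∈ polyForms n r j :=
    fun ℓ => hu (ℓ ∘ₗ contract (φ 0) j)
  rw [map_add, pullForm_koszul]
  exact add_mem (Submodule.mem_sup_left (pullForm_mem_polyForms φ hw))
    (add_mem (Submodule.mem_sup_right ⟨_, pullForm_mem_polyForms φ hu, rfl⟩)
      (Submodule.mem_sup_left (pullForm_mem_polyForms φ hcontract)))

end PolyForms

section ExteriorDerivative

variable {r : ℕ}

theorem extD_add : ∀ {j : ℕ} {v w : Form n j}, Differentiable ℝ v → Differentiable ℝ w →
    extD j (v + w) = extD j v + extD j w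
  | 0, _, _, _, _ => (add_zero _).symm
  | k + 1, v, _, hv, hw => funext fun x =>
      extDeriv_add (show DifferentiableAt ℝ (show Euc n → Euc n [⋀^Fin k]→L[ℝ] ℝ from v) x from
        hv x) (hw x)

theorem extD_smul (c : ℝ) : ∀ {j : ℕ} (v : Form n j), extD j (c • v) = c • extD j v
  | 0, _ => (smul_zero _).symm
  | k + 1, v =>
      funext fun _ => extDeriv_smul c (show Euc n → Euc n [⋀^Fin k]→L[ℝ] ℝ from v)

@[simp] theorem extD_zero (j : ℕ) : extD j (0 : Form n j) = 0 := by
  simpa using extD_smul 0 (0 : Form n j)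

theorem extD_pullForm (φ : Euc n →ᴬ[ℝ] Euc n) : ∀ {j : ℕ} {v : Form n j}, Differentiable ℝ v →
    extD j (pullForm φ j v) = pullForm φ (j + 1) (extD j v)
  | 0, _, _ => (map_zero _).symm
  | k + 1, v, hv => funext fun x => by
      have hd : DifferentiableAt ℝ (show Euc n → Euc n [⋀^Fin k]→L[ℝ] ℝ from v) (φ x) := hv _
      have h := extDeriv_pullback (r := 2) hd φ.contDiff.contDiffAt (by simp)
      simp only [φ.fderiv] at h
      exact h

/-- The antisymmetrization that maps the derivative of a form to its exterior derivative. -/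
def skew (n k : ℕ) : (Euc n →L[ℝ] Alt (Euc n) (k + 1)) →ₗ[ℝ] Alt (Euc n) (k + 2) :=
  (ContinuousAlternatingMap.alternatizeUncurryFinCLM ℝ (Euc n) ℝ (n := k)).toLinearMap

theorem extD_eq_skew {k : ℕ} (v : Form n (k + 1)) (x : Euc n) :
    extD (k + 1) v x = skew n k (fderiv ℝ v x) := rfl

theorem continuous_extD : ∀ {j : ℕ} {v : Form n j}, ContDiff ℝ 1 v → Continuous (extD j v)
  | 0, _, _ => continuous_const (y := (0 : Alt (Euc n) 1))
  | k + 1, _, hv =>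
      (skew n k).continuous_of_finiteDimensional.comp (hv.continuous_fderiv one_ne_zero)

theorem clm_eq_sum_smulRight {F : Type*} [NormedAddCommGroup F] [NormedSpace ℝ F]
    (D : Euc n →L[ℝ] F) :
    D = ∑ l, (EuclideanSpace.proj l : Euc n →L[ℝ] ℝ).smulRight
      (D (EuclideanSpace.single l 1)) := by
  refine ContinuousLinearMap.ext fun y => ?_
  conv_lhs => rw [eq_sum_single y]
  simp [sum_apply]

theorem fderiv_apply_mem_polyForms {j : ℕ} {v : Form n j} (hv : v ∈ polyForms n (r + 1) j)
    (e : Euc n) : (fun x => fderiv ℝ v x e) ∈ polyForms n r j := fun ℓ => by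
  have hcomp : ∀ x, fderiv ℝ (fun y => ℓ (v y)) x e = ℓ (fderiv ℝ v x e) := fun x => by
    have h := ((LinearMap.toContinuousLinearMap ℓ).hasFDerivAt.comp x
      (differentiable_of_mem_polyForms hv x).hasFDerivAt).fderiv
    exact congrArg (· e) h
  simpa only [hcomp] using (hv ℓ).fderiv_apply e

theorem extD_mem_polyForms : ∀ {j : ℕ} {v : Form n j}, v ∈ polyForms n (r + 1) j →
    extD j v ∈ polyForms n r (j + 1)
  | 0, _, _ => Submodule.zero_mem _
  | k + 1, v, hv => fun ℓ => by
      let coordPart (l : Fin n) : Alt (Euc n) (k + 1) →ₗ[ℝ] ℝ := ℓ ∘ₗ skew n k ∘ₗ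
        (ContinuousLinearMap.smulRightL ℝ (Euc n) (Alt (Euc n) (k + 1))
          (EuclideanSpace.proj l)).toLinearMap
      have hcoord : (fun x => ℓ (extD (k + 1) v x)) = fun x =>
          ∑ l, coordPart l (fderiv ℝ v x (EuclideanSpace.single l 1)) := by
        funext x
        exact (congrArg (ℓ ∘ₗ skew n k) (clm_eq_sum_smulRight (fderiv ℝ v x))).trans
          (map_sum (ℓ ∘ₗ skew n k) _ _)
      rw [hcoord]
      exact IsPoly.sum _ fun l => fderiv_apply_mem_polyForms hv _ (coordPart l)

end ExteriorDerivative

section LocalSpaces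

variable {r j : ℕ}

theorem lowSpace_le (r j : ℕ) : ∀ κ, lowSpace n r j κ ≤ polyForms n (r + 1) j
  | .full => le_rfl
  | .trimmed => trimmedForms_le r j

theorem highSpace_le (r j : ℕ) : ∀ κ, highSpace n r j κ ≤ polyForms n (r + 1) j
  | .full => polyForms_mono (Nat.le_succ r) j
  | .trimmed => trimmedForms_le r j

theorem polyForms_le_highSpace (r j : ℕ) : ∀ κ, polyForms n r j ≤ highSpace n r j κ
  | .full => le_rfl
  | .trimmed => le_sup_left

theorem extD_mem_highSpace {κ₀ : Kind} (κ₁ : Kind) {v : Form n j}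
    (hv : v ∈ lowSpace n r j κ₀) : extD j v ∈ highSpace n r (j + 1) κ₁ :=
  polyForms_le_highSpace r (j + 1) κ₁ (extD_mem_polyForms (lowSpace_le r j κ₀ hv))

/-- Invariance of a space of forms under pullback by affine equivalences: the local spaces on
different simplices then correspond to each other. -/
def IsAffineInvariant (S : Submodule ℝ (Form n j)) : Prop :=
  ∀ φ : Euc n ≃ᴬ[ℝ] Euc n, ∀ v ∈ S, pullForm φ j v ∈ S

theorem isAffineInvariant_polyForms (r j : ℕ) : IsAffineInvariant (polyForms n r j) :=
  fun φ _ hv => pullForm_mem_polyForms φ.toContinuousAffineMap hv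

theorem isAffineInvariant_trimmedForms (r j : ℕ) : IsAffineInvariant (trimmedForms n r j) :=
  fun φ _ hv => pullForm_mem_trimmedForms φ.toContinuousAffineMap hv

theorem isAffineInvariant_lowSpace (r j : ℕ) : ∀ κ, IsAffineInvariant (lowSpace n r j κ)
  | .full => isAffineInvariant_polyForms (r + 1) j
  | .trimmed => isAffineInvariant_trimmedForms r j

theorem isAffineInvariant_highSpace (r j : ℕ) : ∀ κ, IsAffineInvariant (highSpace n r j κ)
  | .full => isAffineInvariant_polyForms r j
  | .trimmed => isAffineInvariant_trimmedForms r j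

end LocalSpaces

/-! ### Integrals over simplices and their boundaries -/

section L2

variable {j : ℕ} {U : Set (Euc n)}

theorem MemL2.integrable {α β : Form n j} (hα : MemL2 U α) (hβ : MemL2 U β) :
    Integrable (fun x => altInner
      (fun i : Fin n => EuclideanSpace.single i (1 : ℝ)) j (α x) (β x)) (volume.restrict U) := by
  cases j with
  | zero => exact integrable_zero _ _ _
  | succ k =>
      refine Integrable.const_mul (integrable_finsetSum _ fun I _ => ?_) _
      let coeff : Alt (Euc n) (k + 1) →L[ℝ] ℝ := LinearMap.toContinuousLinearMap
        { toFun := fun ξ => ξ.form (fun i => EuclideanSpace.single (I i) 1)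
          map_add' := fun _ _ => rfl
          map_smul' := fun _ _ => rfl }
      exact (coeff.comp_memLp' hα).integrable_mul (coeff.comp_memLp' hβ)

theorem ip_comm (U : Set (Euc n)) (α β : Form n j) : ip U α β = ip U β α := by
  simp only [ip, altInner_comm _ _ (α _)]

theorem ip_add_left {α α' β : Form n j} (hα : MemL2 U α) (hα' : MemL2 U α') (hβ : MemL2 U β) :
    ip U (α + α') β = ip U α β + ip U α' β := by
  rw [ip, ip, ip, ← integral_add (hα.integrable hβ) (hα'.integrable hβ)]
  simp only [Pi.add_apply, altInner_add_left]

theorem ip_smul_left (U : Set (Euc n)) (c : ℝ) (α β : Form n j) :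
    ip U (c • α) β = c * ip U α β := by
  rw [ip, ip, ← integral_const_mul]
  simp only [Pi.smul_apply, altInner_smul_left]

@[simp] theorem ip_zero_left (U : Set (Euc n)) (β : Form n j) : ip U 0 β = 0 := by
  simp [ip]

@[simp] theorem ip_zero_right (U : Set (Euc n)) (β : Form n j) : ip U β 0 = 0 := by
  simp [ip]

theorem ip_self_nonneg (U : Set (Euc n)) (α : Form n j) : 0 ≤ ip U α α :=
  integral_nonneg fun _ => altInner_self_nonneg _ _ _

theorem nrm_nonneg (U : Set (Euc n)) (α : Form n j) : 0 ≤ nrm U α := Real.sqrt_nonneg _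

theorem nrm_sq (U : Set (Euc n)) (α : Form n j) : nrm U α ^ 2 = ip U α α :=
  Real.sq_sqrt (ip_self_nonneg U α)

variable (j U) in
/-- The square-integrable forms on `U`, not identified up to null sets. -/
def l2Forms : Submodule ℝ (Form n j) where
  carrier := {α | MemL2 U α}
  zero_mem' := MemLp.zero
  add_mem' := MemLp.add
  smul_mem' := fun c _ h => MemLp.const_smul h c

variable (j U) in
/-- The `L²` inner product as a bilinear form; it is only semidefinite, since forms are not
identified up to null sets. -/
def ipBilin : LinearMap.BilinForm ℝ (l2Forms j U) :=
  LinearMap.mk₂ ℝ (fun α β => ip U α.1 β.1)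
    (fun α α' β => ip_add_left α.2 α'.2 β.2)
    (fun c α β => ip_smul_left U c α.1 β.1)
    (fun α β β' => by
      simp only [ip_comm U α.1]
      exact ip_add_left β.2 β'.2 α.2)
    (fun c α β => by
      simp only [ip_comm U α.1]
      exact ip_smul_left U c β.1 α.1)

theorem ip_sub_left {α α' β : Form n j} (hα : MemL2 U α) (hα' : MemL2 U α') (hβ : MemL2 U β) :
    ip U (α - α') β = ip U α β - ip U α' β :=
  LinearMap.map_sub₂ (ipBilin j U) ⟨α, hα⟩ ⟨α', hα'⟩ ⟨β, hβ⟩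

theorem ip_sub_right {α β β' : Form n j} (hα : MemL2 U α) (hβ : MemL2 U β) (hβ' : MemL2 U β') :
    ip U α (β - β') = ip U α β - ip U α β' :=
  map_sub (ipBilin j U ⟨α, hα⟩) ⟨β, hβ⟩ ⟨β', hβ'⟩

theorem abs_ip_le {α β : Form n j} (hα : MemL2 U α) (hβ : MemL2 U β) :
    |ip U α β| ≤ nrm U α * nrm U β := by
  have cauchySchwarz : ip U α β ^ 2 ≤ ip U α α * ip U β β :=
    (ipBilin j U).apply_sq_le_of_symm (fun α => ip_self_nonneg U α.1)
      ⟨fun α β => ip_comm U α.1 β.1⟩ ⟨α, hα⟩ ⟨β, hβ⟩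
  refine abs_le_of_sq_le_sq ?_ (mul_nonneg (nrm_nonneg U α) (nrm_nonneg U β))
  rwa [mul_pow, nrm_sq, nrm_sq]

theorem memL2_cell_of_continuous (K : Finset (Euc n)) {α : Form n j} (hα : Continuous α) :
    MemL2 (cell K) α := by
  have hK := isCompact_cell K
  obtain ⟨M, hM⟩ := hK.exists_bound_of_continuousOn hα.continuousOn
  have : IsFiniteMeasure (volume.restrict (cell K)) := ⟨by
    rw [Measure.restrict_apply_univ]; exact hK.measure_lt_top⟩
  exact MemLp.of_bound hα.aestronglyMeasurable M
    ((ae_restrict_iff' hK.isClosed.measurableSet).2 (Filter.Eventually.of_forall hM))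

end L2

section Boundary

variable {j : ℕ} {K K' : Finset (Euc n)}

theorem bdIp_comm (s t : TanField K j) : bdIp K s t = bdIp K t s := by
  simp only [bdIp, altInner_comm _ j (s _ _)]

theorem bdIp_smul_left (c : ℝ) (s t : TanField K j) : bdIp K (c • s) t = c * bdIp K s t := by
  simp only [bdIp, Pi.smul_apply, altInner_smul_left, integral_const_mul, Finset.mul_sum]

theorem bdIp_zero_right (s : TanField K j) : bdIp K s 0 = 0 := by
  rw [bdIp_comm, ← zero_smul ℝ (0 : TanField K j), bdIp_smul_left, zero_mul]

theorem bdIp_self_nonneg (s : TanField K j) : 0 ≤ bdIp K s s :=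
  Finset.sum_nonneg fun _ _ => integral_nonneg fun _ => altInner_self_nonneg _ _ _

theorem tanTrace_apply_of_mem {v : {v // v ∈ K}} {x : Euc n} (hx : x ∈ facet K v)
    (τ : Form n j) : tanTrace K j τ v x = pullback (facetDir K v).subtypeL j (τ x) := by
  simp only [tanTrace, LinearMap.pi_apply]
  rw [if_pos hx]
  rfl

theorem tanTrace_apply_of_notMem {v : {v // v ∈ K}} {x : Euc n} (hx : x ∉ facet K v)
    (τ : Form n j) : tanTrace K j τ v x = 0 := by
  simp only [tanTrace, LinearMap.pi_apply]
  rw [if_neg hx]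
  rfl

theorem bdIp_tanTrace (τ η : Form n j) :
    bdIp K (tanTrace K j τ) (tanTrace K j η) =
      ∑ v, ∫ x in facet K v, tanInner (facetDir K v) j (τ x) (η x) ∂μHE[n - 1] := by
  refine Finset.sum_congr rfl fun v _ =>
    setIntegral_congr_fun (isCompact_facet K v).isClosed.measurableSet fun x hx => ?_
  simp only [tanTrace_apply_of_mem hx]
  rfl

namespace IsSimplex

theorem integrableOn_facet (hK : IsSimplex K) (hn : 0 < n) (v : {v // v ∈ K})
    {g : Euc n → ℝ} (hg : Continuous g) : IntegrableOn g (facet K v) μHE[n - 1] := by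
  rw [← hK.finrank_facetDir hn v]
  exact integrableOn_convexHull (finite_sdiff_singleton K v) hg

theorem bdIp_tanTrace_add_left (hK : IsSimplex K) (hn : 0 < n) {τ τ' η : Form n j}
    (hτ : Continuous τ) (hτ' : Continuous τ') (hη : Continuous η) :
    bdIp K (tanTrace K j τ + tanTrace K j τ') (tanTrace K j η) =
      bdIp K (tanTrace K j τ) (tanTrace K j η) + bdIp K (tanTrace K j τ') (tanTrace K j η) := by
  rw [← map_add, bdIp_tanTrace, bdIp_tanTrace, bdIp_tanTrace, ← Finset.sum_add_distrib]
  refine Finset.sum_congr rfl fun v _ => ?_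
  rw [← integral_add (hK.integrableOn_facet hn v (continuous_tanInner _ _ hτ hη))
    (hK.integrableOn_facet hn v (continuous_tanInner _ _ hτ' hη))]
  simp only [tanInner, Pi.add_apply, map_add, altInner_add_left]

theorem tanTrace_eq_zero_of_bdIp_self (hK : IsSimplex K) (hn : 0 < n) {τ : Form n j}
    (hτ : Continuous τ) (h : bdIp K (tanTrace K j τ) (tanTrace K j τ) = 0) :
    tanTrace K j τ = 0 := by
  rw [bdIp_tanTrace, Finset.sum_eq_zero_iff_of_nonneg fun _ _ =>
    integral_nonneg fun _ => tanInner_self_nonneg _ _ _] at h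
  funext v x
  by_cases hx : x ∈ facet K v
  · have hv := h v (Finset.mem_univ v)
    rw [← hK.finrank_facetDir hn v] at hv
    exact (tanTrace_apply_of_mem hx τ).trans <| pullback_subtypeL_eq_zero_of_tanInner_self <|
      eqOn_zero_of_setIntegral_convexHull_eq_zero (finite_sdiff_singleton K v)
        (continuous_tanInner _ j hτ hτ) (fun x => tanInner_self_nonneg _ _ _) hv x hx
  · exact tanTrace_apply_of_notMem hx τ

theorem setIntegral_facet_tanInner_pullForm_le (hK : IsSimplex K) (hK' : IsSimplex K')
    (hn : 0 < n) (φ : Euc n ≃ᴬ[ℝ] Euc n) {v : {v // v ∈ K}} {v' : {v // v ∈ K'}}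
    (hfacet : φ '' facet K v = facet K' v')
    (hdir : (facetDir K v).map (linPart φ : Euc n →ₗ[ℝ] Euc n) = facetDir K' v')
    (k : ℕ) {τ : Form n (k + 1)} (hτ : Continuous τ) :
    ∫ x in facet K v, tanInner (facetDir K v) (k + 1) (pullForm φ (k + 1) τ x)
        (pullForm φ (k + 1) τ x) ∂μHE[n - 1] ≤
      n ^ k * ‖linPart φ‖ ^ (2 * k) * (‖linPart φ.symm‖ ^ (n - 1) *
        ∫ x in facet K' v', tanInner (facetDir K' v') (k + 1) (τ x) (τ x) ∂μHE[n - 1]) := by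
  set c : ℝ := n ^ k * ‖linPart φ‖ ^ (2 * k)
  set g : Euc n → ℝ := fun x => tanInner (facetDir K' v') (k + 1) (τ x) (τ x)
  have hg : Continuous g := continuous_tanInner _ _ hτ hτ
  have hpointwise : ∀ x, tanInner (facetDir K v) (k + 1) (pullForm φ (k + 1) τ x)
      (pullForm φ (k + 1) τ x) ≤ c * g (φ x) := fun x => by
    have h := tanInner_pullback_le (D := facetDir K' v') (D' := facetDir K v) (A := linPart φ)
      (fun y hy => hdir ▸ Submodule.mem_map_of_mem hy) k (τ (φ x))
    rwa [finrank_euclideanSpace_fin] at h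
  calc ∫ x in facet K v, tanInner (facetDir K v) (k + 1) (pullForm φ (k + 1) τ x)
        (pullForm φ (k + 1) τ x) ∂μHE[n - 1]
      ≤ ∫ x in facet K v, c * g (φ x) ∂μHE[n - 1] :=
        integral_mono_of_nonneg (Filter.Eventually.of_forall fun x => tanInner_self_nonneg _ _ _)
          ((hK.integrableOn_facet hn v (hg.comp φ.continuous)).const_mul c)
          (Filter.Eventually.of_forall hpointwise)
    _ = c * ∫ x in facet K v, g (φ x) ∂μHE[n - 1] := integral_const_mul _ _
    _ ≤ c * (‖linPart φ.symm‖ ^ (n - 1) * ∫ x in facet K' v', g x ∂μHE[n - 1]) := by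
        rw [← hfacet]
        refine mul_le_mul_of_nonneg_left ?_ (by positivity)
        exact setIntegral_comp_continuousAffineEquiv_le φ (n - 1) _
          (fun x => tanInner_self_nonneg _ _ _)
          (hfacet ▸ hK'.integrableOn_facet hn v' hg)

theorem bdIp_tanTrace_pullForm_le (hK : IsSimplex K) (hK' : IsSimplex K') (hn : 0 < n)
    (φ : Euc n ≃ᴬ[ℝ] Euc n) (h : φ '' (K : Set (Euc n)) = K') (k : ℕ) {τ : Form n (k + 1)}
    (hτ : Continuous τ) :
    bdIp K (tanTrace K (k + 1) (pullForm φ (k + 1) τ))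
        (tanTrace K (k + 1) (pullForm φ (k + 1) τ)) ≤
      n ^ k * ‖linPart φ‖ ^ (2 * k) * (‖linPart φ.symm‖ ^ (n - 1) *
        bdIp K' (tanTrace K' (k + 1) τ) (tanTrace K' (k + 1) τ)) := by
  obtain ⟨e, he⟩ := exists_equiv_facets φ h
  rw [bdIp_tanTrace, bdIp_tanTrace, ← e.sum_comp, Finset.mul_sum, Finset.mul_sum]
  exact Finset.sum_le_sum fun v _ =>
    setIntegral_facet_tanInner_pullForm_le hK hK' hn φ (he v).1 (he v).2 k hτ

end IsSimplex

end Boundary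

/-! ### Lifting of traces -/

section PosDef

theorem exists_bound_norm_sq {E : Type*} [NormedAddCommGroup E] [InnerProductSpace ℝ E]
    [FiniteDimensional ℝ E] (B : LinearMap.BilinForm ℝ E) :
    ∃ C : ℝ, 0 ≤ C ∧ ∀ x, B x x ≤ C * inner ℝ x x := by
  let L : E →L[ℝ] E →L[ℝ] ℝ := LinearMap.toContinuousLinearMap
    ((LinearMap.toContinuousLinearMap (𝕜 := ℝ) (E := E) (F' := ℝ)).toLinearMap.comp B)
  refine ⟨‖L‖, norm_nonneg L, fun x => ?_⟩
  rw [real_inner_self_eq_norm_mul_norm, ← mul_assoc]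
  exact (le_abs_self _).trans (L.le_opNorm₂ x x)

theorem exists_bound_of_posDef {E : Type*} [AddCommGroup E] [Module ℝ E] [FiniteDimensional ℝ E]
    {B : LinearMap.BilinForm ℝ E} (hs : ∀ x y, B x y = B y x) (h0 : ∀ x, 0 ≤ B x x)
    (hd : ∀ x, B x x = 0 → x = 0) (B' : LinearMap.BilinForm ℝ E) :
    ∃ C : ℝ, 0 ≤ C ∧ ∀ x, B' x x ≤ C * B x x := by
  let core : InnerProductSpace.Core ℝ E :=
    { inner := fun x y => B x y
      conj_inner_symm := fun x y => hs y x
      re_inner_nonneg := h0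
      add_left := LinearMap.map_add₂ B
      smul_left := fun x y r => LinearMap.map_smul₂ B r x y
      definite := hd }
  exact @exists_bound_norm_sq E core.toNormedAddCommGroup (InnerProductSpace.ofCore core.toCore)
    ‹_› B'

end PosDef

section LocalLift

variable {j : ℕ} {S : Submodule ℝ (Form n j)} {K : Finset (Euc n)}

/-- The boundary inner product as a bilinear form on the space of traces of continuous forms. -/
def IsSimplex.bdBilin (hK : IsSimplex K) (hn : 0 < n) (hS : ∀ τ ∈ S, Continuous τ) :
    LinearMap.BilinForm ℝ (tanSpace K S) := by
  have add_left : ∀ s s' t : tanSpace K S,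
      bdIp K (s + s').1 t.1 = bdIp K s.1 t.1 + bdIp K s'.1 t.1 := by
    rintro ⟨_, τ, hτ, rfl⟩ ⟨_, τ', hτ', rfl⟩ ⟨_, η, hη, rfl⟩
    exact hK.bdIp_tanTrace_add_left hn (hS τ hτ) (hS τ' hτ') (hS η hη)
  exact LinearMap.mk₂ ℝ (fun s t => bdIp K s.1 t.1) add_left
    (fun c s t => bdIp_smul_left c s.1 t.1)
    (fun s t t' => by rw [bdIp_comm, add_left, bdIp_comm, bdIp_comm t'.1])
    (fun c s t => by rw [bdIp_comm, bdIp_comm s.1]; exact bdIp_smul_left c t.1 s.1)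

theorem IsSimplex.bdIp_sub_left (hK : IsSimplex K) (hn : 0 < n) (hS : ∀ τ ∈ S, Continuous τ)
    {s s' t : TanField K j} (hs : s ∈ tanSpace K S) (hs' : s' ∈ tanSpace K S)
    (ht : t ∈ tanSpace K S) : bdIp K (s - s') t = bdIp K s t - bdIp K s' t :=
  LinearMap.map_sub₂ (hK.bdBilin hn hS) ⟨s, hs⟩ ⟨s', hs'⟩ ⟨t, ht⟩

/-- The `H Λ` inner product `(τ, η)_K + (dτ, dη)_K` on a space of `C¹` forms. -/
def graphBilin (K : Finset (Euc n)) (hS : ∀ τ ∈ S, ContDiff ℝ 1 τ) :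
    LinearMap.BilinForm ℝ S :=
  let incl : S →ₗ[ℝ] l2Forms j (cell K) :=
    { toFun := fun τ => ⟨τ.1, memL2_cell_of_continuous K (hS τ.1 τ.2).continuous⟩
      map_add' := fun _ _ => rfl
      map_smul' := fun _ _ => rfl }
  let d : S →ₗ[ℝ] l2Forms (j + 1) (cell K) :=
    { toFun := fun τ => ⟨extD j τ.1, memL2_cell_of_continuous K (continuous_extD (hS τ.1 τ.2))⟩
      map_add' := fun τ η => Subtype.ext <| extD_add ((hS τ.1 τ.2).differentiable one_ne_zero)
        ((hS η.1 η.2).differentiable one_ne_zero)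
      map_smul' := fun c τ => Subtype.ext <| extD_smul c τ.1 }
  (ipBilin j (cell K)).compl₁₂ incl incl + (ipBilin (j + 1) (cell K)).compl₁₂ d d

theorem IsSimplex.exists_lift (hK : IsSimplex K) (hn : 0 < n) [FiniteDimensional ℝ S]
    (hS : ∀ τ ∈ S, ContDiff ℝ 1 τ) :
    ∃ C : ℝ, 0 ≤ C ∧ ∀ s ∈ tanSpace K S, ∃ τ ∈ S, tanTrace K j τ = s ∧
      ip (cell K) τ τ + ip (cell K) (extD j τ) (extD j τ) ≤ C * bdIp K s s := by
  obtain ⟨lift, hlift⟩ := ((tanTrace K j).submoduleMap S).exists_rightInverse_of_surjective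
    (LinearMap.range_eq_top.2 ((tanTrace K j).submoduleMap_surjective S))
  have hcont : ∀ τ ∈ S, Continuous τ := fun τ hτ => (hS τ hτ).continuous
  have definite : ∀ s, hK.bdBilin hn hcont s s = 0 → s = 0 := by
    rintro ⟨_, τ, hτ, rfl⟩ h
    exact Subtype.ext (hK.tanTrace_eq_zero_of_bdIp_self hn (hcont τ hτ) h)
  have : FiniteDimensional ℝ (tanSpace K S) :=
    inferInstanceAs (FiniteDimensional ℝ (S.map (tanTrace K j)))
  obtain ⟨C, hC, hbound⟩ := exists_bound_of_posDef (B := hK.bdBilin hn hcont)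
    (fun s t => bdIp_comm s.1 t.1) (fun s => bdIp_self_nonneg s.1) definite
    ((graphBilin K hS).compl₁₂ lift lift)
  exact ⟨C, hC, fun s hs => ⟨lift ⟨s, hs⟩, (lift ⟨s, hs⟩).2,
    congrArg Subtype.val (LinearMap.congr_fun hlift ⟨s, hs⟩), hbound ⟨s, hs⟩⟩⟩

end LocalLift

section Scaling

variable {K K₀ : Finset (Euc n)}

theorem triNorm_nonneg {j : ℕ} (s : TanField K j) : 0 ≤ triNorm K s :=
  mul_nonneg (Real.sqrt_nonneg _) (Real.sqrt_nonneg _)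

theorem cellDiam_nonneg (K : Finset (Euc n)) : 0 ≤ cellDiam K := Metric.diam_nonneg

theorem triNorm_sq {j : ℕ} (s : TanField K j) : triNorm K s ^ 2 = cellDiam K * bdIp K s s := by
  rw [triNorm, mul_pow, Real.sq_sqrt (cellDiam_nonneg K), Real.sq_sqrt (bdIp_self_nonneg s)]

theorem IsSimplex.tanTrace_pullForm_eq_zero (hK : IsSimplex K) (hK₀ : IsSimplex K₀) (hn : 0 < n)
    (φ : Euc n ≃ᴬ[ℝ] Euc n) (h : φ '' (K : Set (Euc n)) = K₀) {k : ℕ} {τ : Form n (k + 1)}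
    (hτ : Continuous τ) (h0 : tanTrace K₀ (k + 1) τ = 0) :
    tanTrace K (k + 1) (pullForm φ (k + 1) τ) = 0 := by
  have hle := hK.bdIp_tanTrace_pullForm_le hK₀ hn φ h k hτ
  have hzero : bdIp K₀ (0 : TanField K₀ (k + 1)) 0 = 0 := by simp [bdIp]
  rw [h0, hzero, mul_zero, mul_zero] at hle
  exact hK.tanTrace_eq_zero_of_bdIp_self hn (continuous_pullForm _ _ hτ)
    (hle.antisymm (bdIp_self_nonneg _))

theorem ip_add_ip_extD_pullForm_le (φ : Euc n ≃ᴬ[ℝ] Euc n) {S : Set (Euc n)} (hS : IsCompact S)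
    {k : ℕ} {η : Form n (k + 1)} (hη : ContDiff ℝ 1 η) {a b h : ℝ} (hh : 0 < h)
    (hb : ‖linPart φ‖ ≤ b / h) (ha : ‖linPart φ.symm‖ ≤ a) :
    ip S (pullForm φ (k + 1) η) (pullForm φ (k + 1) η) + h ^ 2 *
        ip S (extD (k + 1) (pullForm φ (k + 1) η)) (extD (k + 1) (pullForm φ (k + 1) η)) ≤
      n ^ k * (b / h) ^ (2 * k) * (a ^ n * ((1 + n * b ^ 2) * (ip (φ '' S) η η +
        ip (φ '' S) (extD (k + 1) η) (extD (k + 1) η)))) := by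
  set E := ip (φ '' S) η η
  set E' := ip (φ '' S) (extD (k + 1) η) (extD (k + 1) η)
  have hE : 0 ≤ E := ip_self_nonneg _ _
  have hE' : 0 ≤ E' := ip_self_nonneg _ _
  have ha0 : 0 ≤ a := (norm_nonneg _).trans ha
  have hb0 : 0 ≤ b / h := (norm_nonneg _).trans hb
  have hle := (ip_pullForm_le φ hS k hη.continuous).trans
    (show _ ≤ n ^ k * (b / h) ^ (2 * k) * (a ^ n * E) by gcongr)
  have hle' := (ip_pullForm_le φ hS (k + 1) (continuous_extD hη)).trans
    (show _ ≤ n ^ (k + 1) * (b / h) ^ (2 * (k + 1)) * (a ^ n * E') by gcongr)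
  rw [extD_pullForm φ (hη.differentiable one_ne_zero)]
  calc _ ≤ n ^ k * (b / h) ^ (2 * k) * (a ^ n * E) +
        h ^ 2 * (n ^ (k + 1) * (b / h) ^ (2 * (k + 1)) * (a ^ n * E')) := by gcongr
    _ = n ^ k * (b / h) ^ (2 * k) * (a ^ n * (E + n * b ^ 2 * E')) := by
        have hbh : h ^ 2 * (b / h) ^ 2 = b ^ 2 := by field_simp
        linear_combination n ^ (k + 1) * (b / h) ^ (2 * k) * a ^ n * E' * hbh
    _ ≤ _ := by
        gcongr
        nlinarith [mul_nonneg (mul_nonneg n.cast_nonneg (sq_nonneg b)) hE]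

theorem scaling_identity (a b : ℝ) {h : ℝ} (hh : h ≠ 0) (hn : 0 < n) (k : ℕ) :
    (b / h) ^ (2 * k) * (a * h) ^ n * ((a * h) ^ (2 * k) * (b / h) ^ (n - 1)) =
      (a * b) ^ (2 * k) * a ^ n * b ^ (n - 1) * h := by
  obtain ⟨m, rfl⟩ : ∃ m, n = m + 1 := ⟨n - 1, by omega⟩
  have cancel : b / h * (a * h) = a * b := by field_simp
  calc _ = (b / h * (a * h)) ^ (2 * k) * (b / h * (a * h)) ^ m * (a * h) := by
        rw [Nat.add_sub_cancel, mul_pow (b / h), mul_pow (b / h), pow_succ (a * h) m]; ring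
    _ = _ := by rw [cancel, Nat.add_sub_cancel]; ring

theorem norm_linPart_le {φ : Euc n ≃ᴬ[ℝ] Euc n} (hφ : φ '' (K : Set (Euc n)) = K₀) {c : Euc n}
    {ρ : ℝ} (hρ : 0 < ρ) (hc : Metric.ball c ρ ⊆ cell K) : ‖linPart φ‖ ≤ 2 * cellDiam K₀ / ρ :=
  norm_contLinear_le_of_ball_subset φ.toContinuousAffineMap (isCompact_cell K₀).isBounded
    (image_cell φ hφ ▸ Set.mapsTo_image φ (cell K)) hρ hc

variable {k : ℕ} {S : Submodule ℝ (Form n (k + 1))}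

theorem IsSimplex.exists_lift_of_affineEquiv (hK : IsSimplex K) (hK₀ : IsSimplex K₀) (hn : 0 < n)
    (hS : ∀ τ ∈ S, ContDiff ℝ 1 τ) (hinv : IsAffineInvariant S) {C₀ a b : ℝ} (hC₀ : 0 ≤ C₀)
    (hlift : ∀ s ∈ tanSpace K₀ S, ∃ τ ∈ S, tanTrace K₀ (k + 1) τ = s ∧
      ip (cell K₀) τ τ + ip (cell K₀) (extD (k + 1) τ) (extD (k + 1) τ) ≤ C₀ * bdIp K₀ s s)
    (φ : Euc n ≃ᴬ[ℝ] Euc n) (hφ : φ '' (K : Set (Euc n)) = K₀)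
    (ha : ‖linPart φ.symm‖ ≤ a * cellDiam K) (hb : ‖linPart φ‖ ≤ b / cellDiam K)
    {s : TanField K (k + 1)} (hs : s ∈ tanSpace K S) :
    ∃ τ ∈ S, tanTrace K (k + 1) τ = s ∧
      ip (cell K) τ τ + cellDiam K ^ 2 * ip (cell K) (extD (k + 1) τ) (extD (k + 1) τ) ≤
        n ^ k * n ^ k * (1 + n * b ^ 2) * C₀ * (a * b) ^ (2 * k) * a ^ n * b ^ (n - 1) *
          triNorm K s ^ 2 := by
  obtain ⟨τ₀, hτ₀, rfl⟩ := hs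
  set h := cellDiam K
  have hh : 0 < h := hK.cellDiam_pos hn
  have hb0 : 0 ≤ b / h := (norm_nonneg _).trans hb
  set η₀ := pullForm φ.symm (k + 1) τ₀
  have hη₀ : η₀ ∈ S := hinv φ.symm τ₀ hτ₀
  have hback : pullForm φ (k + 1) η₀ = τ₀ := pullForm_pullForm_symm φ (k + 1) τ₀
  obtain ⟨η, hη, htrace, hbound⟩ := hlift _ (Submodule.mem_map_of_mem hη₀)
  have hφ' : φ.symm '' (K₀ : Set (Euc n)) = K := by
    rw [← hφ]; exact φ.toEquiv.symm_image_image _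
  have hboundary := hK₀.bdIp_tanTrace_pullForm_le hK hn φ.symm hφ' k (hS τ₀ hτ₀).continuous
  rw [φ.symm_symm] at hboundary
  set β := bdIp K (tanTrace K (k + 1) τ₀) (tanTrace K (k + 1) τ₀) with hβ
  have hβ0 : 0 ≤ β := bdIp_self_nonneg _
  refine ⟨_, hinv φ η hη, ?_, ?_⟩
  · have hzero := hK.tanTrace_pullForm_eq_zero hK₀ hn φ hφ (τ := η - η₀)
      (hS _ (S.sub_mem hη hη₀)).continuous (by rw [map_sub, htrace, sub_self])
    rwa [map_sub, map_sub, sub_eq_zero, hback] at hzero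
  · have hscaled := ip_add_ip_extD_pullForm_le φ (isCompact_cell K) (hS η hη) hh hb ha
    rw [image_cell φ hφ] at hscaled
    refine hscaled.trans ?_
    have ha0 : 0 ≤ a * h := (norm_nonneg _).trans ha
    calc _ ≤ n ^ k * (b / h) ^ (2 * k) * ((a * h) ^ n * ((1 + n * b ^ 2) *
          (C₀ * (n ^ k * (a * h) ^ (2 * k) * ((b / h) ^ (n - 1) * β))))) := by
          gcongr
          exact hbound.trans (mul_le_mul_of_nonneg_left
            (hboundary.trans (by gcongr)) hC₀)
      _ = _ := by
          rw [triNorm_sq, ← hβ]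
          linear_combination
            n ^ k * n ^ k * (1 + n * b ^ 2) * C₀ * β * scaling_identity a b hh.ne' hn k

end Scaling

section UniformLift

variable {γ : ℝ}

theorem exists_uniform_sq_lift_succ (hn : 0 < n) (hγ : 0 < γ) {k : ℕ}
    (S : Submodule ℝ (Form n (k + 1))) [FiniteDimensional ℝ S] (hS : ∀ τ ∈ S, ContDiff ℝ 1 τ)
    (hinv : IsAffineInvariant S) :
    ∃ C : ℝ, 0 ≤ C ∧ ∀ K : Finset (Euc n), IsSimplex K →
      (∃ c, Metric.ball c (cellDiam K / γ) ⊆ cell K) → ∀ s ∈ tanSpace K S,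
        ∃ τ ∈ S, tanTrace K (k + 1) τ = s ∧
          ip (cell K) τ τ + cellDiam K ^ 2 * ip (cell K) (extD (k + 1) τ) (extD (k + 1) τ) ≤
            C * triNorm K s ^ 2 := by
  by_cases hex : ∃ K₀ : Finset (Euc n), IsSimplex K₀
  swap
  · exact ⟨0, le_rfl, fun K hK => (hex ⟨K, hK⟩).elim⟩
  obtain ⟨K₀, hK₀⟩ := hex
  obtain ⟨C₀, hC₀, hlift⟩ := hK₀.exists_lift hn hS
  obtain ⟨c₀, hc₀⟩ := hK₀.interior_cell_nonempty
  obtain ⟨ρ, hρ, hball₀⟩ := Metric.isOpen_iff.1 isOpen_interior c₀ hc₀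
  let a := 2 / ρ
  let b := 2 * cellDiam K₀ * γ
  have : 0 ≤ a := by positivity
  have hb : 0 ≤ b := mul_nonneg (mul_nonneg zero_le_two (cellDiam_nonneg K₀)) hγ.le
  refine ⟨n ^ k * n ^ k * (1 + n * b ^ 2) * C₀ * (a * b) ^ (2 * k) * a ^ n * b ^ (n - 1),
    by positivity, fun K hK hball s hs => ?_⟩
  obtain ⟨φ, hφ⟩ := hK.exists_continuousAffineEquiv_image_eq hK₀
  have hφ' : φ.symm '' (K₀ : Set (Euc n)) = K := by
    rw [← hφ]; exact φ.toEquiv.symm_image_image _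
  have hback : ‖linPart φ.symm‖ ≤ a * cellDiam K := by
    rw [div_mul_eq_mul_div]
    exact norm_linPart_le hφ' hρ (hball₀.trans interior_subset)
  have hforth : ‖linPart φ‖ ≤ b / cellDiam K := by
    obtain ⟨c, hc⟩ := hball
    refine (norm_linPart_le hφ (div_pos (hK.cellDiam_pos hn) hγ) hc).trans_eq ?_
    rw [div_div_eq_mul_div]
  exact hK.exists_lift_of_affineEquiv hK₀ hn hS hinv hC₀ hlift φ hφ hback hforth hs

theorem exists_uniform_sq_lift (hn : 0 < n) (hγ : 0 < γ) {j : ℕ} (S : Submodule ℝ (Form n j))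
    [FiniteDimensional ℝ S] (hS : ∀ τ ∈ S, ContDiff ℝ 1 τ) (hinv : IsAffineInvariant S) :
    ∃ C : ℝ, 0 ≤ C ∧ ∀ K : Finset (Euc n), IsSimplex K →
      (∃ c, Metric.ball c (cellDiam K / γ) ⊆ cell K) → ∀ s ∈ tanSpace K S,
        ∃ τ ∈ S, tanTrace K j τ = s ∧
          ip (cell K) τ τ + cellDiam K ^ 2 * ip (cell K) (extD j τ) (extD j τ) ≤
            C * triNorm K s ^ 2 := by
  cases j with
  | zero =>
    refine ⟨0, le_rfl, fun K _ _ s ⟨τ, hτ, htrace⟩ => ⟨τ, hτ, htrace, ?_⟩⟩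
    have hτ0 : τ = 0 := rfl
    have hd : extD 0 τ = 0 := rfl
    rw [hd, hτ0, ip_zero_left, ip_zero_left, mul_zero, zero_mul, add_zero]
  | succ k => exact exists_uniform_sq_lift_succ hn hγ S hS hinv

theorem sqrt_le_and_mul_sqrt_le {C h E E' N : ℝ} (hC : 0 ≤ C) (hh : 0 ≤ h) (hE : 0 ≤ E)
    (hE' : 0 ≤ E') (hN : 0 ≤ N) (hle : E + h ^ 2 * E' ≤ C * N ^ 2) :
    √E ≤ √C * N ∧ h * √E' ≤ √C * N := by
  have hhE' : 0 ≤ h ^ 2 * E' := by positivity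
  have hN' : √(C * N ^ 2) = √C * N := by rw [Real.sqrt_mul hC, Real.sqrt_sq hN]
  have hhE : √(h ^ 2 * E') = h * √E' := by rw [Real.sqrt_mul (sq_nonneg h), Real.sqrt_sq hh]
  rw [← hN', ← hhE]
  exact ⟨Real.sqrt_le_sqrt (by linarith), Real.sqrt_le_sqrt (by linarith)⟩

/-- `C` bounds the lifting of traces on `∂K` to forms in `S`: every trace is attained by a form
`τ` in `S` with `‖τ‖_K` and `h_K ‖dτ‖_K` at most `C` times its scaled norm. -/
def IsLiftBound (C : ℝ) {j : ℕ} (K : Finset (Euc n)) (S : Submodule ℝ (Form n j)) : Prop :=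
  ∀ s ∈ tanSpace K S, ∃ τ ∈ S, tanTrace K j τ = s ∧ nrm (cell K) τ ≤ C * triNorm K s ∧
    cellDiam K * nrm (cell K) (extD j τ) ≤ C * triNorm K s

theorem IsLiftBound.mono {C C' : ℝ} (hCC' : C ≤ C') {j : ℕ} {K : Finset (Euc n)}
    {S : Submodule ℝ (Form n j)} (h : IsLiftBound C K S) : IsLiftBound C' K S := by
  intro s hs
  obtain ⟨τ, hτ, htrace, hnrm, hnrm_d⟩ := h s hs
  have hle := mul_le_mul_of_nonneg_right hCC' (triNorm_nonneg s)
  exact ⟨τ, hτ, htrace, hnrm.trans hle, hnrm_d.trans hle⟩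

theorem exists_isLiftBound (hn : 0 < n) (hγ : 0 < γ) {j : ℕ} (S : Submodule ℝ (Form n j))
    [FiniteDimensional ℝ S] (hS : ∀ τ ∈ S, ContDiff ℝ 1 τ) (hinv : IsAffineInvariant S) :
    ∃ C : ℝ, ∀ K : Finset (Euc n), IsSimplex K →
      (∃ c, Metric.ball c (cellDiam K / γ) ⊆ cell K) → IsLiftBound C K S := by
  obtain ⟨C, hC, h⟩ := exists_uniform_sq_lift hn hγ S hS hinv
  refine ⟨√C, fun K hK hball s hs => ?_⟩
  obtain ⟨τ, hτ, htrace, hbound⟩ := h K hK hball s hs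
  exact ⟨τ, hτ, htrace, sqrt_le_and_mul_sqrt_le hC (cellDiam_nonneg K) (ip_self_nonneg _ _)
    (ip_self_nonneg _ _) (triNorm_nonneg s) hbound⟩

end UniformLift

/-! ### Integration by parts and test forms -/

section IntegrationByParts

section Bilinear

variable {E V W : Type*} [NormedAddCommGroup E] [MeasurableSpace E] [BorelSpace E]
  [NormedAddCommGroup V] [NormedSpace ℝ V] [NormedAddCommGroup W] [NormedSpace ℝ W]
  (μ : Measure E) (B : V →L[ℝ] W →L[ℝ] ℝ)

theorem integrable_bilin_of_hasCompactSupport [IsFiniteMeasureOnCompacts μ] {f : E → V}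
    {g : E → W} (hf : Continuous f) (hg : Continuous g) (hgc : HasCompactSupport g) :
    Integrable (fun x => B (f x) (g x)) μ :=
  ((B.continuous.comp hf).clm_apply hg).integrable_of_hasCompactSupport <|
    HasCompactSupport.intro hgc fun x hx => by
      rw [image_eq_zero_of_notMem_tsupport hx, map_zero]

theorem integral_bilin_fderiv_left_eq_neg_right [NormedSpace ℝ E] [FiniteDimensional ℝ E]
    [μ.IsAddHaarMeasure] {f : E → V} {g : E → W} (hf : ContDiff ℝ 1 f) (hg : ContDiff ℝ 1 g)
    (hgc : HasCompactSupport g) (v : E) :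
    ∫ x, B (fderiv ℝ f x v) (g x) ∂μ = -∫ x, B (f x) (fderiv ℝ g x v) ∂μ := by
  have hf' : Continuous fun x => fderiv ℝ f x v :=
    (hf.continuous_fderiv one_ne_zero).clm_apply continuous_const
  have hg' : Continuous fun x => fderiv ℝ g x v :=
    (hg.continuous_fderiv one_ne_zero).clm_apply continuous_const
  rw [integral_bilinear_fderiv_right_eq_neg_left_of_integrable
    (integrable_bilin_of_hasCompactSupport μ B hf' hg.continuous hgc)
    (integrable_bilin_of_hasCompactSupport μ B hf.continuous hg' (hgc.fderiv_apply (𝕜 := ℝ) v))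
    (integrable_bilin_of_hasCompactSupport μ B hf.continuous hg.continuous hgc)
    (fun x _ => hf.differentiable one_ne_zero x) (fun x _ => hg.differentiable one_ne_zero x),
    neg_neg]

end Bilinear

theorem skew_apply {k : ℕ} (F : Euc n →L[ℝ] Alt (Euc n) (k + 1)) (v : Fin (k + 1) → Euc n) :
    (skew n k F).form v =
      ∑ p : Fin (k + 1), (-1) ^ (p : ℕ) * (F (v p)).form (p.removeNth v) := by
  refine (ContinuousAlternatingMap.alternatizeUncurryFin_apply _ v).trans
    (Finset.sum_congr rfl fun p _ => ?_)
  rw [zsmul_eq_mul]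
  push_cast
  rfl

section

variable {ι V : Type} [Fintype ι] [NormedAddCommGroup V] [NormedSpace ℝ V]

theorem form_contract {k : ℕ} (x : V) (η : Alt V (k + 2)) (p : Fin (k + 1)) (v : Fin k → V) :
    (contract x (k + 1) η).form v = (-1) ^ (p : ℕ) * η.form (p.insertNth x v) := by
  have := η.form.neg_one_pow_smul_map_insertNth p x v
  rw [zsmul_eq_mul] at this
  push_cast at this
  exact this.symm

theorem sum_removeNth_mul_form_eq_sum_contract {k : ℕ} (b : ι → V)
    (F : V →L[ℝ] Alt V (k + 1)) (η : Alt V (k + 2)) (p : Fin (k + 1)) :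
    ∑ I : Fin (k + 1) → ι, (-1) ^ (p : ℕ) * (F (b (I p))).form (p.removeNth fun i => b (I i)) *
        η.form (fun i => b (I i)) =
      ∑ l, ∑ I : Fin k → ι, (F (b l)).form (fun i => b (I i)) *
        (contract (b l) (k + 1) η).form fun i => b (I i) := by
  rw [← (Fin.insertNthEquiv (fun _ => ι) p).sum_comp, Fintype.sum_prod_type]
  refine Finset.sum_congr rfl fun l _ => Finset.sum_congr rfl fun I _ => ?_
  have hcomp : (fun i => b ((Fin.insertNthEquiv (fun _ => ι) p) (l, I) i)) =
      p.insertNth (α := fun _ => V) (b l) fun i => b (I i) := by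
    funext i
    refine Fin.succAboveCases p ?_ (fun i => ?_) i <;> simp
  rw [hcomp, Fin.removeNth_insertNth, form_contract (b l) η p]
  simp only [Fin.insertNthEquiv_apply, Fin.insertNth_apply_same]
  ring

end

section Adjoint

variable {ι : Type} [Fintype ι] (b : ι → Euc n)

theorem altInner_skew (k : ℕ) (F : Euc n →L[ℝ] Alt (Euc n) (k + 1)) (η : Alt (Euc n) (k + 2)) :
    altInner b (k + 2) (skew n k F) η =
      ∑ l, altInner b (k + 1) (F (b l)) (contract (b l) (k + 1) η) := by
  calc altInner b (k + 2) (skew n k F) η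
      = ((k + 1).factorial : ℝ)⁻¹ * ∑ p : Fin (k + 1), ∑ I : Fin (k + 1) → ι,
          (-1) ^ (p : ℕ) * (F (b (I p))).form (p.removeNth fun i => b (I i)) *
            η.form fun i => b (I i) := by
        rw [Finset.sum_comm]
        simp only [← Finset.sum_mul, ← skew_apply]
        rfl
    _ = (k.factorial : ℝ)⁻¹ * ∑ l, ∑ I : Fin k → ι, (F (b l)).form (fun i => b (I i)) *
          (contract (b l) (k + 1) η).form fun i => b (I i) := by
        simp only [sum_removeNth_mul_form_eq_sum_contract, Finset.sum_const, Finset.card_univ,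
          Fintype.card_fin, nsmul_eq_mul, Nat.factorial_succ]
        push_cast
        field_simp
    _ = ∑ l, altInner b (k + 1) (F (b l)) (contract (b l) (k + 1) η) := Finset.mul_sum ..

theorem altInner_extD : ∀ (j : ℕ) (τ : Form n j) (x : Euc n) (η : Alt (Euc n) (j + 1)),
    altInner b (j + 1) (extD j τ x) η =
      ∑ l, altInner b j (fderiv ℝ τ x (b l)) (contract (b l) j η)
  | 0, τ, x, η => by
    have hd : extD 0 τ x = 0 := rfl
    rw [hd, altInner_zero_left]
    simp [altInner]
  | k + 1, τ, x, η => by rw [extD_eq_skew, altInner_skew]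

/-- The bilinear map `(α, β) ↦ ⟨α, ι_v β⟩`. -/
def contractBilin (v : Euc n) (j : ℕ) : Alt (Euc n) j →L[ℝ] Alt (Euc n) (j + 1) →L[ℝ] ℝ :=
  ((altBilin b j).compl₂ (contract v j)).toContinuousBilinearMap

theorem contractBilin_apply (v : Euc n) (j : ℕ) (α : Alt (Euc n) j) (β : Alt (Euc n) (j + 1)) :
    contractBilin b v j α β = altInner b j α (contract v j β) := rfl

end Adjoint

variable {j : ℕ}

theorem altInner_codiff (α : Alt (Euc n) j) (η : Form n (j + 1)) (x : Euc n) :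
    altInner (fun i : Fin n => EuclideanSpace.single i (1 : ℝ)) j α (codiff j η x) =
      -∑ l, contractBilin (fun i : Fin n => EuclideanSpace.single i (1 : ℝ))
        (EuclideanSpace.single l 1) j α (fderiv ℝ η x (EuclideanSpace.single l 1)) := by
  simp only [← altBilin_apply, codiff, map_neg, map_sum]
  rfl

theorem integral_altInner_extD {τ : Form n j} {η : Form n (j + 1)} (hτ : ContDiff ℝ 1 τ)
    (hη : ContDiff ℝ 1 η) (hηc : HasCompactSupport η) :
    ∫ x, altInner (fun i : Fin n => EuclideanSpace.single i (1 : ℝ)) (j + 1) (extD j τ x) (η x) =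
      ∫ x, altInner (fun i : Fin n => EuclideanSpace.single i (1 : ℝ)) j (τ x)
        (codiff j η x) := by
  have hdτ (v : Euc n) : Continuous fun x => fderiv ℝ τ x v :=
    (hτ.continuous_fderiv one_ne_zero).clm_apply continuous_const
  have hdη (v : Euc n) : Continuous fun x => fderiv ℝ η x v :=
    (hη.continuous_fderiv one_ne_zero).clm_apply continuous_const
  simp only [altInner_extD, ← contractBilin_apply, altInner_codiff, integral_neg]
  rw [integral_finsetSum _ fun l _ =>
      integrable_bilin_of_hasCompactSupport volume _ (hdτ _) hη.continuous hηc,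
    integral_finsetSum _ fun l _ => integrable_bilin_of_hasCompactSupport volume _ hτ.continuous
      (hdη _) (hηc.fderiv_apply (𝕜 := ℝ) _), ← Finset.sum_neg_distrib]
  exact Finset.sum_congr rfl fun l _ =>
    integral_bilin_fderiv_left_eq_neg_right volume _ hτ hη hηc _

end IntegrationByParts

section TestForms

variable {j : ℕ} {U U' : Set (Euc n)}

theorem extD_eq_zero_of_notMem_tsupport : ∀ {j : ℕ} {τ : Form n j} {x : Euc n},
    x ∉ tsupport τ → extD j τ x = 0
  | 0, _, _, _ => rfl
  | k + 1, _, _, hx => by rw [extD_eq_skew, fderiv_of_notMem_tsupport ℝ hx, map_zero]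

theorem hasCompactSupport_extD {τ : Form n j} (hτ : HasCompactSupport τ) :
    HasCompactSupport (extD j τ) :=
  HasCompactSupport.intro hτ fun _ hx => extD_eq_zero_of_notMem_tsupport hx

theorem memL2_of_hasCompactSupport (U : Set (Euc n)) {τ : Form n j} (hc : Continuous τ)
    (hs : HasCompactSupport τ) : MemL2 U τ :=
  (hc.memLp_of_hasCompactSupport hs).restrict U

theorem ip_eq_integral_of_right (α : Form n j) {β : Form n j} (h : ∀ x ∉ U, β x = 0) :
    ip U α β = ∫ x, altInner (fun i : Fin n => EuclideanSpace.single i (1 : ℝ)) j (α x) (β x) :=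
  setIntegral_eq_integral_of_forall_compl_eq_zero fun x hx => by rw [h x hx, altInner_zero_right]

theorem ip_eq_of_subset (hU : U ⊆ U') (α : Form n j) {β : Form n j} (h : ∀ x ∉ U, β x = 0) :
    ip U' α β = ip U α β := by
  rw [ip_eq_integral_of_right α h, ip_eq_integral_of_right α fun x hx => h x (mt (@hU x) hx)]

namespace IsTest

theorem mono (hU : U ⊆ U') {τ : Form n j} (hτ : IsTest U τ) : IsTest U' τ :=
  ⟨hτ.1, hτ.2.1, hτ.2.2.trans hU⟩

theorem contDiff_one {τ : Form n j} (hτ : IsTest U τ) : ContDiff ℝ 1 τ := hτ.1.of_le (by simp)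

theorem memL2 {τ : Form n j} (hτ : IsTest U τ) : MemL2 U τ :=
  memL2_of_hasCompactSupport U hτ.1.continuous hτ.2.1

theorem eq_zero {τ : Form n j} (hτ : IsTest U τ) {x : Euc n} (hx : x ∉ U) : τ x = 0 :=
  image_eq_zero_of_notMem_tsupport fun h => hx (hτ.2.2 h)

theorem extD_eq_zero {τ : Form n j} (hτ : IsTest U τ) {x : Euc n} (hx : x ∉ U) :
    extD j τ x = 0 :=
  extD_eq_zero_of_notMem_tsupport fun h => hx (hτ.2.2 h)

theorem isWeakD {τ : Form n j} (hτ : IsTest U τ) : IsWeakD U τ (extD j τ) := by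
  refine ⟨hτ.memL2, memL2_of_hasCompactSupport U (continuous_extD hτ.contDiff_one)
    (hasCompactSupport_extD hτ.2.1), fun η hη => ?_⟩
  rw [ip_eq_integral_of_right _ fun x hx => hη.eq_zero hx, ip_comm,
    ip_eq_integral_of_right _ fun x hx => hτ.eq_zero hx,
    integral_altInner_extD hτ.contDiff_one hη.contDiff_one hη.2.1]
  simp only [altInner_comm _ j (τ _)]

theorem smul_const {g : Euc n → ℝ} (hg : ContDiff ℝ ∞ g) (hgc : HasCompactSupport g)
    (hgU : tsupport g ⊆ U) (α : Alt (Euc n) j) : IsTest U fun x => g x • α :=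
  ⟨hg.smul contDiff_const, hgc.smul_right, (tsupport_smul_subset_left g fun _ => α).trans hgU⟩

end IsTest

theorem ip_smul_const_left {g : Euc n → ℝ} {w : Form n j}
    (hint : IntegrableOn (fun x => g x • w x) U) (α : Alt (Euc n) j) :
    ip U (fun x => g x • α) w =
      altInner (fun i : Fin n => EuclideanSpace.single i (1 : ℝ)) j α (∫ x in U, g x • w x) := by
  let L : Alt (Euc n) j →L[ℝ] ℝ := LinearMap.toContinuousLinearMap
    (altBilin (fun i : Fin n => EuclideanSpace.single i (1 : ℝ)) j α)
  refine Eq.trans (integral_congr_ae (.of_forall fun x => ?_)) (L.integral_comp_comm hint)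
  exact (altInner_smul_left _ j (g x) α (w x)).trans (L.map_smul (g x) (w x)).symm

theorem ae_eq_zero_of_forall_isTest (hU : IsOpen U) {w : Form n j} (hw : MemL2 U w)
    (h : ∀ τ : Form n j, IsTest U τ → ip U τ w = 0) : w =ᵐ[volume.restrict U] 0 := by
  have hloc : LocallyIntegrable w (volume.restrict U) := MemLp.locallyIntegrable hw one_le_two
  refine (ae_restrict_iff' hU.measurableSet).2 <|
    hU.ae_eq_zero_of_integral_contDiff_smul_eq_zero
      (locallyIntegrableOn_of_locallyIntegrable_restrict hloc) fun g hg hgc hgU => ?_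
  have hint : IntegrableOn (fun x => g x • w x) U :=
    hloc.integrable_smul_left_of_hasCompactSupport hg.continuous hgc
  rw [← setIntegral_eq_integral_of_forall_compl_eq_zero (s := U) fun x hx => by
    rw [image_eq_zero_of_notMem_tsupport fun hx' => hx (hgU hx'), zero_smul]]
  refine eq_zero_of_altInner_self (EuclideanSpace.basisFun (Fin n) ℝ) j _ ?_
  rw [← altInner_single, ← ip_smul_const_left hint]
  exact h _ (IsTest.smul_const hg hgc hgU _)

theorem ae_eq_of_forall_isTest (hU : IsOpen U) {w w' : Form n j} (hw : MemL2 U w)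
    (hw' : MemL2 U w') (h : ∀ τ : Form n j, IsTest U τ → ip U τ w = ip U τ w') :
    w =ᵐ[volume.restrict U] w' := by
  refine (ae_eq_zero_of_forall_isTest hU (hw.sub hw') fun τ hτ => ?_).mono
    fun x hx => sub_eq_zero.1 hx
  rw [ip_sub_right hτ.memL2 hw hw', h τ hτ, sub_self]

end TestForms

section Triangulation

variable {j : ℕ} {K : Finset (Euc n)} {T : Finset (Finset (Euc n))}

theorem restrict_interior_cell (K : Finset (Euc n)) :
    (volume : Measure (Euc n)).restrict (interior (cell K)) = volume.restrict (cell K) :=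
  Measure.restrict_congr_set <|
    interior_ae_eq_of_null_frontier ((convex_cell K).addHaar_frontier volume)

theorem memL2_interior_cell {α : Form n j} :
    MemL2 (interior (cell K)) α ↔ MemL2 (cell K) α := by
  rw [MemL2, MemL2, restrict_interior_cell]

theorem cellDiam_le_meshSize (hK : K ∈ T) : cellDiam K ≤ meshSize T :=
  le_ciSup (f := fun K : {K // K ∈ T} => cellDiam K.1) (Set.finite_range _).bddAbove ⟨K, hK⟩

namespace IsTriangulation

variable {Ω : Set (Euc n)}

theorem isSimplex (hT : IsTriangulation Ω T) (hK : K ∈ T) : IsSimplex K := by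
  obtain ⟨𝒦, h𝒦, -⟩ := hT.exists_complex
  have hK' : K ∈ 𝒦.facets := h𝒦 ▸ hK
  exact ⟨𝒦.indep (𝒦.facets_subset hK'), hT.card_eq K hK⟩

theorem interior_cell_subset (hT : IsTriangulation Ω T) (hK : K ∈ T) :
    interior (cell K) ⊆ Ω := by
  obtain ⟨𝒦, h𝒦, rfl⟩ := hT.exists_complex
  have hK' : K ∈ 𝒦.facets := h𝒦 ▸ hK
  exact interior_mono (𝒦.convexHull_subset_space (𝒦.facets_subset hK'))

theorem memL2_interior_cell (hT : IsTriangulation Ω T) (hK : K ∈ T) {α : Form n j}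
    (hα : MemL2 Ω α) : MemL2 (interior (cell K)) α :=
  MemLp.mono_measure (Measure.restrict_mono (hT.interior_cell_subset hK) le_rfl) hα

theorem memL2_cell (hT : IsTriangulation Ω T) (hK : K ∈ T) {α : Form n j} (hα : MemL2 Ω α) :
    MemL2 (cell K) α :=
  HybridFEEC.memL2_interior_cell.1 (hT.memL2_interior_cell hK hα)

end IsTriangulation

end Triangulation

section Single

variable [DecidableEq (Finset (Euc n))] {j : ℕ} {K : Finset (Euc n)}
  {T : Finset (Finset (Euc n))}

theorem memW_single {S : Submodule ℝ (Form n j)} {τ : Form n j} (hτ : τ ∈ S) :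
    MemW T S (Pi.single K τ) := by
  intro L _
  rcases eq_or_ne L K with rfl | h
  · rwa [Pi.single_eq_same]
  · rw [Pi.single_eq_of_ne h]
    exact S.zero_mem

theorem bD_single (τ : Form n j) :
    bD (Pi.single K τ) = (Pi.single K (extD j τ) : Broken n (j + 1)) :=
  funext fun L => Pi.apply_single (fun _ => extD j) (fun _ => extD_zero j) K τ L

theorem bip_single (hK : K ∈ T) (α : Broken n j) (τ : Form n j) :
    bip T α (Pi.single K τ) = ip (cell K) (α K) τ := by
  rw [bip, Finset.sum_eq_single_of_mem K hK fun L _ h => by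
    rw [Pi.single_eq_of_ne h, ip_zero_right], Pi.single_eq_same]

theorem bbdIp_bTan_single (hK : K ∈ T) (s : BrokenTan n j) (τ : Form n j) :
    bbdIp T s (bTan (Pi.single K τ)) = bdIp K (s K) (tanTrace K j τ) := by
  rw [bbdIp, Finset.sum_eq_single_of_mem K hK fun L _ h => by
    rw [bTan, Pi.single_eq_of_ne h, map_zero, bdIp_zero_right], bTan, Pi.single_eq_same]

theorem sum_traceDuality_single (hK : K ∈ T) (τ : Form n j) (v : Form n (j + 1))
    (δv : Broken n j) :
    ∑ L ∈ T, traceDuality L ((Pi.single K τ : Broken n j) L)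
        (extD j ((Pi.single K τ : Broken n j) L)) v (δv L) =
      traceDuality K τ (extD j τ) v (δv K) := by
  rw [Finset.sum_eq_single_of_mem K hK fun L _ h => by
    rw [Pi.single_eq_of_ne h, extD_zero, traceDuality, ip_zero_left, ip_zero_left, sub_zero],
    Pi.single_eq_same]

end Single

/-! ### Error estimates -/

theorem IsLiftBound.triNorm_le {j : ℕ} {K : Finset (Euc n)} {S : Submodule ℝ (Form n j)}
    {C : ℝ} (hC : 0 ≤ C) (hlift : IsLiftBound C K S) {s : TanField K j}
    (hs : s ∈ tanSpace K S) {a b : ℝ} (ha : 0 ≤ a) (hb : 0 ≤ b)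
    (h : ∀ τ ∈ S, bdIp K s (tanTrace K j τ) ≤
      nrm (cell K) (extD j τ) * a + nrm (cell K) τ * b) :
    triNorm K s ≤ C * (a + cellDiam K * b) := by
  obtain ⟨τ, hτ, htrace, hnrm, hnrm_d⟩ := hlift s hs
  have hdiam := cellDiam_nonneg K
  have hpair := htrace ▸ h τ hτ
  have hsq : triNorm K s * triNorm K s ≤ triNorm K s * (C * (a + cellDiam K * b)) :=
    calc triNorm K s * triNorm K s = cellDiam K * bdIp K s s := by rw [← sq, triNorm_sq]
      _ ≤ cellDiam K * (nrm (cell K) (extD j τ) * a + nrm (cell K) τ * b) := by gcongr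
      _ = cellDiam K * nrm (cell K) (extD j τ) * a + nrm (cell K) τ * (cellDiam K * b) := by ring
      _ ≤ C * triNorm K s * a + C * triNorm K s * (cellDiam K * b) := by gcongr
      _ = triNorm K s * (C * (a + cellDiam K * b)) := by ring
  rcases (triNorm_nonneg s).eq_or_lt with hzero | hpos
  · rw [← hzero]
    positivity
  · exact le_of_mul_le_mul_left hsq hpos

section ErrorEquations

variable {Ω : Set (Euc n)} {T : Finset (Finset (Euc n))} {j : ℕ} {f : Form n (j + 1)}
  {σ : Form n j} {dσ u : Form n (j + 1)} {du : Form n (j + 2)} {p : Form n (j + 1)}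
  {K : Finset (Euc n)}

namespace HodgeLaplaceSolution

theorem isWeakCodiff_u_ae_eq (hsol : HodgeLaplaceSolution Ω f σ dσ u du p)
    (hT : IsTriangulation Ω T) (hK : K ∈ T) {w : Form n j}
    (hw : IsWeakCodiff (interior (cell K)) u w) :
    w =ᵐ[volume.restrict (interior (cell K))] σ := by
  have hU := hT.interior_cell_subset hK
  refine ae_eq_of_forall_isTest isOpen_interior hw.2.1
    (hT.memL2_interior_cell hK hsol.sigma_mem.1) fun τ hτ => ?_
  have hexact := hsol.eq_tau τ (extD j τ) (hτ.mono hU).isWeakD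
  rw [ip_eq_of_subset hU σ fun x => hτ.eq_zero, ip_eq_of_subset hU u fun x => hτ.extD_eq_zero,
    sub_eq_zero] at hexact
  rw [hw.2.2 τ hτ, ip_comm, ← hexact, ip_comm]

theorem isWeakCodiff_du_ae_eq (hsol : HodgeLaplaceSolution Ω f σ dσ u du p) (hf : MemL2 Ω f)
    (hT : IsTriangulation Ω T) (hK : K ∈ T) {w : Form n (j + 1)}
    (hw : IsWeakCodiff (interior (cell K)) du w) :
    w =ᵐ[volume.restrict (interior (cell K))] f - dσ - p := by
  have hU := hT.interior_cell_subset hK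
  have hf := hT.memL2_interior_cell hK hf
  have hdσ := hT.memL2_interior_cell hK hsol.sigma_mem.2.1
  have hp := hT.memL2_interior_cell hK hsol.p_mem.1.1
  refine ae_eq_of_forall_isTest isOpen_interior hw.2.1 ((hf.sub hdσ).sub hp) fun v hv => ?_
  have hexact := hsol.eq_v v (extD (j + 1) v) (hv.mono hU).isWeakD
  rw [ip_eq_of_subset hU dσ fun x => hv.eq_zero, ip_eq_of_subset hU p fun x => hv.eq_zero,
    ip_eq_of_subset hU f fun x => hv.eq_zero,
    ip_eq_of_subset hU du fun x => hv.extD_eq_zero] at hexact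
  rw [hw.2.2 v hv, ip_comm, ip_comm _ v, ip_sub_left (hf.sub hdσ) hp hv.memL2,
    ip_sub_left hf hdσ hv.memL2]
  linarith

end HodgeLaplaceSolution

theorem IsNormalTraceProj.bdIp_tanTrace {S : Submodule ℝ (Form n j)} {v : Form n (j + 1)}
    {Pv : BrokenTan n j} (hP : IsNormalTraceProj T S v Pv) (hK : K ∈ T) {w : Form n j}
    (hw : ∀ δ : Form n j, IsWeakCodiff (interior (cell K)) v δ →
      δ =ᵐ[volume.restrict (interior (cell K))] w) {τ : Form n j} (hτ : τ ∈ S) :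
    bdIp K (Pv K) (tanTrace K j τ) = ip (cell K) (extD j τ) v - ip (cell K) τ w := by
  classical
  obtain ⟨-, δv, hδ, hpair⟩ := hP
  have hδw := hw _ (hδ K hK)
  rw [restrict_interior_cell] at hδw
  rw [← bbdIp_bTan_single hK, hpair _ (memW_single hτ), sum_traceDuality_single hK, traceDuality]
  congr 1
  exact integral_congr_ae (hδw.mono fun x hx => by simp only [hx])

theorem IsL2Proj.ip_eq {S : Finset (Euc n) → Submodule ℝ (Form n j)} {w Pw : Broken n j}
    (hP : IsL2Proj T S w Pw) (hK : K ∈ T) {s : Form n j} (hs : s ∈ S K)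
    (hw : MemL2 (cell K) (w K)) (hPw : MemL2 (cell K) (Pw K)) (hsL : MemL2 (cell K) s) :
    ip (cell K) s (w K) = ip (cell K) s (Pw K) := by
  rw [← sub_eq_zero, ← ip_sub_right hsL hw hPw, ip_comm, (hP K hK).2 s hs]

theorem ContinuesComplex.memL2 {S₁ : Submodule ℝ (Form n j)}
    {S₂ : Finset (Euc n) → Submodule ℝ (Form n (j + 1))} (hS₂ : ContinuesComplex T S₁ S₂)
    (hK : K ∈ T) {w : Form n (j + 1)} (hw : w ∈ S₂ K) : MemL2 (cell K) w := by
  obtain ⟨_, hweak⟩ := (hS₂ K hK).2.2 w hw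
  exact memL2_interior_cell.1 hweak.1

variable {S₀ : Submodule ℝ (Form n j)} {S₁ : Submodule ℝ (Form n (j + 1))}
  {σh : Broken n j} {uh pbar : Broken n (j + 1)}
  {unor : BrokenTan n j} {rhonor : BrokenTan n (j + 1)}
  {ph ubar : Broken n (j + 1)} {σtan : BrokenTan n j} {utan : BrokenTan n (j + 1)}

namespace HybridSolution

theorem ip_pbar_eq_zero
    (hsolh : HybridSolution Ω T S₀ S₁ f σh uh pbar unor rhonor ph ubar σtan utan) (hK : K ∈ T)
    (hpbar : MemL2 (cell K) (pbar K)) {v : Form n (j + 1)} (hv : MemL2 (cell K) v) :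
    ip (cell K) (pbar K) v = 0 := by
  have hself : ip (cell K) (pbar K) (pbar K) = 0 :=
    (Finset.sum_eq_zero_iff_of_nonneg fun L _ => ip_self_nonneg (cell L) (pbar L)).1
      (hsolh.eq_vbar _ hsolh.pbar_mem) K hK
  have hle := abs_ip_le hpbar hv
  rw [nrm, hself, Real.sqrt_zero, zero_mul] at hle
  exact abs_nonpos_iff.1 hle

theorem bdIp_unor (hsolh : HybridSolution Ω T S₀ S₁ f σh uh pbar unor rhonor ph ubar σtan utan)
    (hK : K ∈ T) {τ : Form n j} (hτ : τ ∈ S₀) :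
    bdIp K (unor K) (tanTrace K j τ) =
      ip (cell K) (extD j τ) (uh K) - ip (cell K) τ (σh K) := by
  classical
  have hdiscrete := hsolh.eq_tau _ (memW_single (K := K) hτ)
  rw [bD_single, bip_single hK, bip_single hK, bbdIp_bTan_single hK] at hdiscrete
  rw [ip_comm _ _ (uh K), ip_comm _ τ]
  linarith

theorem bdIp_rhonor
    (hsolh : HybridSolution Ω T S₀ S₁ f σh uh pbar unor rhonor ph ubar σtan utan)
    (hS₁ : ∀ v ∈ S₁, Continuous v) (hK : K ∈ T) {v : Form n (j + 1)} (hv : v ∈ S₁) :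
    bdIp K (rhonor K) (tanTrace K (j + 1) v) =
      ip (cell K) (extD (j + 1) v) (bD uh K) -
        (ip (cell K) f v - ip (cell K) (bD σh K) v - ip (cell K) (ph K) v) := by
  classical
  have memL2 {η : Form n (j + 1)} (hη : η ∈ S₁) : MemL2 (cell K) η :=
    memL2_cell_of_continuous K (hS₁ η hη)
  have hpbar := memL2 (hsolh.pbar_mem K hK).1
  have hdiscrete := hsolh.eq_v _ (memW_single (K := K) hv)
  rw [bD_single, bip_single hK, bip_single hK, bip_single hK, bip_single hK,
    bbdIp_bTan_single hK, Pi.add_apply, ip_add_left hpbar (memL2 (hsolh.p_mem.1.1 K hK))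
    (memL2 hv), hsolh.ip_pbar_eq_zero hK hpbar (memL2 hv)] at hdiscrete
  rw [ip_comm _ _ (bD uh K)]
  linarith

end HybridSolution

theorem bdIp_unor_error (hn : 0 < n) (hT : IsTriangulation Ω T)
    (hS₀ : ∀ τ ∈ S₀, Continuous τ) (hS₁ : ∀ v ∈ S₁, Continuous v)
    (hd : ∀ τ ∈ S₀, extD j τ ∈ S₁) (hsol : HodgeLaplaceSolution Ω f σ dσ u du p)
    (hsolh : HybridSolution Ω T S₀ S₁ f σh uh pbar unor rhonor ph ubar σtan utan)
    {Punor : BrokenTan n j} (hP : IsNormalTraceProj T S₀ u Punor)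
    {Pu : Broken n (j + 1)} (hPu : IsL2Proj T (fun _ => S₁) (fun _ => u) Pu)
    (hK : K ∈ T) {τ : Form n j} (hτ : τ ∈ S₀) :
    bdIp K (Punor K - unor K) (tanTrace K j τ) =
      ip (cell K) (extD j τ) (Pu K - uh K) - ip (cell K) τ (σ - σh K) := by
  have memL2₀ {η : Form n j} (hη : η ∈ S₀) := memL2_cell_of_continuous K (hS₀ η hη)
  have memL2₁ {η : Form n (j + 1)} (hη : η ∈ S₁) := memL2_cell_of_continuous K (hS₁ η hη)
  have hPuK := memL2₁ (hPu K hK).1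
  have hproj := hPu.ip_eq hK (hd τ hτ) (hT.memL2_cell hK hsol.u_mem.1) hPuK (memL2₁ (hd τ hτ))
  rw [(hT.isSimplex hK).bdIp_sub_left hn hS₀ (hP.1 K hK) (hsolh.unor_mem K hK)
      (Submodule.mem_map_of_mem hτ),
    hP.bdIp_tanTrace hK (fun δ => hsol.isWeakCodiff_u_ae_eq hT hK) hτ, hsolh.bdIp_unor hK hτ,
    hproj, ip_sub_right (memL2₁ (hd τ hτ)) hPuK (memL2₁ (hsolh.u_mem K hK)),
    ip_sub_right (memL2₀ hτ) (hT.memL2_cell hK hsol.sigma_mem.1)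
      (memL2₀ (hsolh.sigma_mem K hK))]
  ring

theorem bdIp_rhonor_error (hn : 0 < n) (hT : IsTriangulation Ω T) (hf : MemL2 Ω f)
    (hS₀ : ∀ τ ∈ S₀, ContDiff ℝ 1 τ) (hS₁ : ∀ v ∈ S₁, ContDiff ℝ 1 v)
    (hsol : HodgeLaplaceSolution Ω f σ dσ u du p)
    (hsolh : HybridSolution Ω T S₀ S₁ f σh uh pbar unor rhonor ph ubar σtan utan)
    {Prhonor : BrokenTan n (j + 1)} (hP : IsNormalTraceProj T S₁ du Prhonor)
    {S₂ : Finset (Euc n) → Submodule ℝ (Form n (j + 2))} (hS₂ : ContinuesComplex T S₁ S₂)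
    {Pde : Broken n (j + 2)} (hPde : IsL2Proj T S₂ (fun K => du - bD uh K) Pde)
    (hK : K ∈ T) {v : Form n (j + 1)} (hv : v ∈ S₁) :
    bdIp K (Prhonor K - rhonor K) (tanTrace K (j + 1) v) =
      ip (cell K) (extD (j + 1) v) (Pde K) +
        (ip (cell K) v (dσ - bD σh K) + ip (cell K) v (p - ph K)) := by
  have memL2 {i : ℕ} {η : Form n i} (hη : ContDiff ℝ 1 η) : MemL2 (cell K) η :=
    memL2_cell_of_continuous K hη.continuous
  have memL2_d {i : ℕ} {η : Form n i} (hη : ContDiff ℝ 1 η) : MemL2 (cell K) (extD i η) :=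
    memL2_cell_of_continuous K (continuous_extD hη)
  have hvL := memL2 (hS₁ v hv)
  have hdv := memL2_d (hS₁ v hv)
  have hfK := hT.memL2_cell hK hf
  have hdσ := hT.memL2_cell hK hsol.sigma_mem.2.1
  have hdu := hT.memL2_cell hK hsol.u_mem.2.1
  have hp := hT.memL2_cell hK hsol.p_mem.1.1
  have hdσh : MemL2 (cell K) (bD σh K) := memL2_d (hS₀ _ (hsolh.sigma_mem K hK))
  have hduh : MemL2 (cell K) (bD uh K) := memL2_d (hS₁ _ (hsolh.u_mem K hK))
  have hph := memL2 (hS₁ _ (hsolh.p_mem.1.1 K hK))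
  have hPdeK := hS₂.memL2 hK (hPde K hK).1
  have hproj := hPde.ip_eq hK ((hS₂ K hK).2.1 v hv) (hdu.sub hduh) hPdeK hdv
  have hcont := fun η hη => (hS₁ η hη).continuous
  rw [(hT.isSimplex hK).bdIp_sub_left hn hcont (hP.1 K hK) (hsolh.rhonor_mem K hK)
      (Submodule.mem_map_of_mem hv),
    hP.bdIp_tanTrace hK (fun δ => hsol.isWeakCodiff_du_ae_eq hf hT hK) hv,
    hsolh.bdIp_rhonor hcont hK hv, ← hproj, ip_sub_right hdv hdu hduh,
    ip_sub_right hvL (hfK.sub hdσ) hp, ip_sub_right hvL hfK hdσ, ip_sub_right hvL hdσ hdσh,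
    ip_sub_right hvL hp hph, ip_comm _ f, ip_comm _ (bD σh K), ip_comm _ (ph K)]
  ring

theorem triNorm_unor_error_le (hn : 0 < n) (hT : IsTriangulation Ω T)
    (hS₀ : ∀ τ ∈ S₀, ContDiff ℝ 1 τ) (hS₁ : ∀ v ∈ S₁, Continuous v)
    (hd : ∀ τ ∈ S₀, extD j τ ∈ S₁) (hsol : HodgeLaplaceSolution Ω f σ dσ u du p)
    (hsolh : HybridSolution Ω T S₀ S₁ f σh uh pbar unor rhonor ph ubar σtan utan)
    {Punor : BrokenTan n j} (hP : IsNormalTraceProj T S₀ u Punor)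
    {Pu : Broken n (j + 1)} (hPu : IsL2Proj T (fun _ => S₁) (fun _ => u) Pu)
    (hK : K ∈ T) {C : ℝ} (hC : 0 ≤ C) (hlift : IsLiftBound C K S₀) :
    triNorm K (Punor K - unor K) ≤
      C * (nrm (cell K) (Pu K - uh K) + cellDiam K * nrm (cell K) (σ - σh K)) := by
  have hcont := fun τ hτ => (hS₀ τ hτ).continuous
  refine hlift.triNorm_le hC (sub_mem (hP.1 K hK) (hsolh.unor_mem K hK)) (nrm_nonneg _ _)
    (nrm_nonneg _ _) fun τ hτ => ?_
  have hu : MemL2 (cell K) (Pu K - uh K) := memL2_cell_of_continuous K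
    ((hS₁ _ (hPu K hK).1).sub (hS₁ _ (hsolh.u_mem K hK)))
  have hσ : MemL2 (cell K) (σ - σh K) := (hT.memL2_cell hK hsol.sigma_mem.1).sub
    (memL2_cell_of_continuous K (hcont _ (hsolh.sigma_mem K hK)))
  rw [bdIp_unor_error hn hT hcont hS₁ hd hsol hsolh hP hPu hK hτ]
  linarith [le_of_abs_le (abs_ip_le (memL2_cell_of_continuous K (hS₁ _ (hd τ hτ))) hu),
    neg_le_of_abs_le (abs_ip_le (memL2_cell_of_continuous K (hcont τ hτ)) hσ)]

theorem triNorm_rhonor_error_le (hn : 0 < n) (hT : IsTriangulation Ω T) (hf : MemL2 Ω f)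
    (hS₀ : ∀ τ ∈ S₀, ContDiff ℝ 1 τ) (hS₁ : ∀ v ∈ S₁, ContDiff ℝ 1 v)
    (hsol : HodgeLaplaceSolution Ω f σ dσ u du p)
    (hsolh : HybridSolution Ω T S₀ S₁ f σh uh pbar unor rhonor ph ubar σtan utan)
    {Prhonor : BrokenTan n (j + 1)} (hP : IsNormalTraceProj T S₁ du Prhonor)
    {S₂ : Finset (Euc n) → Submodule ℝ (Form n (j + 2))} (hS₂ : ContinuesComplex T S₁ S₂)
    {Pde : Broken n (j + 2)} (hPde : IsL2Proj T S₂ (fun K => du - bD uh K) Pde)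
    (hK : K ∈ T) {C : ℝ} (hC : 0 ≤ C) (hlift : IsLiftBound C K S₁) :
    triNorm K (Prhonor K - rhonor K) ≤ C * (nrm (cell K) (Pde K) +
      cellDiam K * (nrm (cell K) (dσ - bD σh K) + nrm (cell K) (p - ph K))) := by
  refine hlift.triNorm_le hC (sub_mem (hP.1 K hK) (hsolh.rhonor_mem K hK)) (nrm_nonneg _ _)
    (add_nonneg (nrm_nonneg _ _) (nrm_nonneg _ _)) fun v hv => ?_
  have hvL := memL2_cell_of_continuous K (hS₁ v hv).continuous
  have hdσ : MemL2 (cell K) (dσ - bD σh K) := (hT.memL2_cell hK hsol.sigma_mem.2.1).sub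
    (memL2_cell_of_continuous K (continuous_extD (hS₀ _ (hsolh.sigma_mem K hK))))
  have hp : MemL2 (cell K) (p - ph K) := (hT.memL2_cell hK hsol.p_mem.1.1).sub
    (memL2_cell_of_continuous K (hS₁ _ (hsolh.p_mem.1.1 K hK)).continuous)
  rw [bdIp_rhonor_error hn hT hf hS₀ hS₁ hsol hsolh hP hS₂ hPde hK hv]
  linarith [le_of_abs_le (abs_ip_le (memL2_cell_of_continuous K (continuous_extD (hS₁ v hv)))
      (hS₂.memL2 hK (hPde K hK).1)),
    le_of_abs_le (abs_ip_le hvL hdσ), le_of_abs_le (abs_ip_le hvL hp)]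

end ErrorEquations

section BrokenNorms

theorem sqrt_sum_add_sq_le {ι : Type*} (s : Finset ι) (f g : ι → ℝ) :
    √(∑ i ∈ s, (f i + g i) ^ 2) ≤ √(∑ i ∈ s, f i ^ 2) + √(∑ i ∈ s, g i ^ 2) := by
  simpa only [← Real.sqrt_eq_rpow, Real.rpow_two, sq_abs] using
    Real.Lp_add_le s f g one_le_two

theorem sqrt_sum_mul_sq {ι : Type*} (s : Finset ι) {c : ℝ} (hc : 0 ≤ c) (f : ι → ℝ) :
    √(∑ i ∈ s, (c * f i) ^ 2) = c * √(∑ i ∈ s, f i ^ 2) := by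
  simp only [mul_pow, ← Finset.mul_sum, Real.sqrt_mul (sq_nonneg c), Real.sqrt_sq hc]

variable {T : Finset (Finset (Euc n))} {i j l : ℕ}

theorem bnrm_eq_sqrt_sum (T : Finset (Finset (Euc n))) (α : Broken n j) :
    bnrm T α = √(∑ K ∈ T, nrm (cell K) (α K) ^ 2) := by
  simp only [bnrm, bip, nrm_sq]

theorem meshSize_nonneg (T : Finset (Finset (Euc n))) : 0 ≤ meshSize T :=
  Real.iSup_nonneg fun K => cellDiam_nonneg K.1

theorem bTriNorm_le {s : BrokenTan n i} {C : ℝ} (hC : 0 ≤ C) (a : Broken n j)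
    {g : Finset (Euc n) → ℝ} (hg : ∀ K, 0 ≤ g K)
    (h : ∀ K ∈ T, triNorm K (s K) ≤ C * (nrm (cell K) (a K) + cellDiam K * g K)) :
    bTriNorm T s ≤ C * (bnrm T a + meshSize T * √(∑ K ∈ T, g K ^ 2)) := by
  have hmesh := meshSize_nonneg T
  have hle (K) (hK : K ∈ T) :
      triNorm K (s K) ≤ C * (nrm (cell K) (a K) + meshSize T * g K) :=
    (h K hK).trans <| by
      have := hg K
      gcongr
      exact cellDiam_le_meshSize hK
  calc bTriNorm T s
      ≤ √(∑ K ∈ T, (C * (nrm (cell K) (a K) + meshSize T * g K)) ^ 2) :=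
        Real.sqrt_le_sqrt <| Finset.sum_le_sum fun K hK =>
          pow_le_pow_left₀ (triNorm_nonneg _) (hle K hK) 2
    _ ≤ C * (√(∑ K ∈ T, nrm (cell K) (a K) ^ 2) + √(∑ K ∈ T, (meshSize T * g K) ^ 2)) := by
        rw [sqrt_sum_mul_sq T hC]
        gcongr
        exact sqrt_sum_add_sq_le ..
    _ = C * (bnrm T a + meshSize T * √(∑ K ∈ T, g K ^ 2)) := by
        rw [sqrt_sum_mul_sq T hmesh, bnrm_eq_sqrt_sum]

theorem sqrt_sum_nrm_add_nrm_sq_le (b : Broken n j) (c : Broken n l) :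
    √(∑ K ∈ T, (nrm (cell K) (b K) + nrm (cell K) (c K)) ^ 2) ≤ bnrm T b + bnrm T c := by
  rw [bnrm_eq_sqrt_sum, bnrm_eq_sqrt_sum]
  exact sqrt_sum_add_sq_le ..

end BrokenNorms

end HybridFEEC

end

theorem mainTheorem7_general {n k : ℕ} (hn : 0 < n) (S₀ : Submodule ℝ (Form n k))
    (S₁ : Submodule ℝ (Form n (k + 1))) [FiniteDimensional ℝ S₀] [FiniteDimensional ℝ S₁]
    (hS₀ : ∀ τ ∈ S₀, ContDiff ℝ 1 τ) (hS₁ : ∀ v ∈ S₁, ContDiff ℝ 1 v)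
    (hinv₀ : IsAffineInvariant S₀) (hinv₁ : IsAffineInvariant S₁)
    (hd : ∀ τ ∈ S₀, extD k τ ∈ S₁) {γ : ℝ} (hγ : 0 < γ) :
    ∃ C : ℝ, 0 < C ∧
      ∀ (Ω : Set (Euc n)) (T : Finset (Finset (Euc n))),
        IsTriangulation Ω T → ShapeRegular γ T →
      ∀ f : Form n (k + 1), MemL2 Ω f →
      ∀ (σ : Form n k) (dσ u : Form n (k + 1)) (du : Form n (k + 2)) (p : Form n (k + 1)),
        HodgeLaplaceSolution Ω f σ dσ u du p →
      ∀ (σh : Broken n k) (uh pbar : Broken n (k + 1))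
        (unor : BrokenTan n k) (rhonor : BrokenTan n (k + 1))
        (ph ubar : Broken n (k + 1)) (σtan : BrokenTan n k) (utan : BrokenTan n (k + 1)),
        HybridSolution Ω T S₀ S₁ f σh uh pbar unor rhonor ph ubar σtan utan →
      ∀ (Punor : BrokenTan n k) (Prhonor : BrokenTan n (k + 1)),
        IsNormalTraceProj T S₀ u Punor →
        IsNormalTraceProj T S₁ du Prhonor →
      ∀ (S₂ : Finset (Euc n) → Submodule ℝ (Form n (k + 2))),
        ContinuesComplex T S₁ S₂ →
      ∀ (Pu : Broken n (k + 1)) (Pde : Broken n (k + 2)),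
        IsL2Proj T (fun _ => S₁) (fun _ => u) Pu →
        IsL2Proj T S₂ (fun K => du - bD uh K) Pde →
      (∀ K ∈ T,
        triNorm K (Punor K - unor K)
          ≤ C * (nrm (cell K) (Pu K - uh K)
              + cellDiam K * nrm (cell K) (σ - σh K))) ∧
      (∀ K ∈ T,
        triNorm K (Prhonor K - rhonor K)
          ≤ C * (nrm (cell K) (Pde K)
              + cellDiam K * (nrm (cell K) (dσ - bD σh K) + nrm (cell K) (p - ph K)))) ∧
      (bTriNorm T (Punor - unor)
          ≤ C * (bnrm T (Pu - uh) + meshSize T * bnrm T (fun K => σ - σh K))) ∧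
      (bTriNorm T (Prhonor - rhonor)
          ≤ C * (bnrm T Pde
              + meshSize T * (bnrm T (fun K => dσ - bD σh K) + bnrm T (fun K => p - ph K)))) := by
  obtain ⟨C₀, hC₀⟩ := exists_isLiftBound hn hγ S₀ hS₀ hinv₀
  obtain ⟨C₁, hC₁⟩ := exists_isLiftBound hn hγ S₁ hS₁ hinv₁
  set C := max 1 (max C₀ C₁)
  have hC : 0 < C := zero_lt_one.trans_le (le_max_left 1 _)
  refine ⟨C, hC, fun Ω T hT hreg f hf σ dσ u du p hsol σh uh pbar unor rhonor ph ubar σtan utan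
    hsolh Punor Prhonor hP₀ hP₁ S₂ hS₂ Pu Pde hPu hPde => ?_⟩
  have hlift₀ : ∀ K ∈ T, IsLiftBound C K S₀ := fun K hK =>
    (hC₀ K (hT.isSimplex hK) (hreg K hK)).mono ((le_max_left C₀ C₁).trans (le_max_right 1 _))
  have hlift₁ : ∀ K ∈ T, IsLiftBound C K S₁ := fun K hK =>
    (hC₁ K (hT.isSimplex hK) (hreg K hK)).mono ((le_max_right C₀ C₁).trans (le_max_right 1 _))
  have hunor := fun K hK => triNorm_unor_error_le hn hT hS₀ (fun v hv => (hS₁ v hv).continuous)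
    hd hsol hsolh hP₀ hPu hK hC.le (hlift₀ K hK)
  have hrhonor := fun K hK => triNorm_rhonor_error_le hn hT hf hS₀ hS₁ hsol hsolh hP₁ hS₂ hPde
    hK hC.le (hlift₁ K hK)
  refine ⟨hunor, hrhonor, ?_, ?_⟩
  · rw [bnrm_eq_sqrt_sum T fun K => σ - σh K]
    exact bTriNorm_le hC.le (Pu - uh) (fun K => nrm_nonneg _ _) hunor
  · refine (bTriNorm_le hC.le Pde (fun K => add_nonneg (nrm_nonneg _ _) (nrm_nonneg _ _))
      hrhonor).trans ?_
    gcongr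
    · exact meshSize_nonneg T
    · exact sqrt_sum_nrm_add_nrm_sq_le _ _

theorem mainTheorem7 (n k r : ℕ) (hn : 0 < n) (hk : k ≤ n) (κ₀ κ₁ : Kind)
    (hr : κ₁ = Kind.full → 1 ≤ r) (γ : ℝ) (hγ : 0 < γ) :
    ∃ C : ℝ, 0 < C ∧
      ∀ (Ω : Set (Euc n)) (T : Finset (Finset (Euc n))),
        IsTriangulation Ω T → ShapeRegular γ T →
      ∀ f : Form n (k + 1), MemL2 Ω f →
      -- the exact solution
      ∀ (σ : Form n k) (dσ u : Form n (k + 1)) (du : Form n (k + 2)) (p : Form n (k + 1)),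
        HodgeLaplaceSolution Ω f σ dσ u du p →
      -- the solution of the hybridized method
      ∀ (σh : Broken n k) (uh pbar : Broken n (k + 1))
        (unor : BrokenTan n k) (rhonor : BrokenTan n (k + 1))
        (ph ubar : Broken n (k + 1)) (σtan : BrokenTan n k) (utan : BrokenTan n (k + 1)),
        HybridSolution Ω T (lowSpace n r k κ₀) (highSpace n r (k + 1) κ₁) f
          σh uh pbar unor rhonor ph ubar σtan utan →
      -- the projected normal traces of `u` and `ρ = du`
      ∀ (Punor : BrokenTan n k) (Prhonor : BrokenTan n (k + 1)),
        IsNormalTraceProj T (lowSpace n r k κ₀) u Punor →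
        IsNormalTraceProj T (highSpace n r (k + 1) κ₁) du Prhonor →
      -- the elementwise `L²` projections of `u` and of `d (u - u_h)`
      ∀ (S₂ : Finset (Euc n) → Submodule ℝ (Form n (k + 2))),
        ContinuesComplex T (highSpace n r (k + 1) κ₁) S₂ →
      ∀ (Pu : Broken n (k + 1)) (Pde : Broken n (k + 2)),
        IsL2Proj T (fun _ => highSpace n r (k + 1) κ₁) (fun _ => u) Pu →
        IsL2Proj T S₂ (fun K => du - bD uh K) Pde →
      (∀ K ∈ T,
        triNorm K (Punor K - unor K)
          ≤ C * (nrm (cell K) (Pu K - uh K)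
              + cellDiam K * nrm (cell K) (σ - σh K))) ∧
      (∀ K ∈ T,
        triNorm K (Prhonor K - rhonor K)
          ≤ C * (nrm (cell K) (Pde K)
              + cellDiam K * (nrm (cell K) (dσ - bD σh K) + nrm (cell K) (p - ph K)))) ∧
      (bTriNorm T (Punor - unor)
          ≤ C * (bnrm T (Pu - uh) + meshSize T * bnrm T (fun K => σ - σh K))) ∧
      (bTriNorm T (Prhonor - rhonor)
          ≤ C * (bnrm T Pde
              + meshSize T * (bnrm T (fun K => dσ - bD σh K) + bnrm T (fun K => p - ph K)))) := by
  have contDiff {j : ℕ} {v : Form n j} (hv : v ∈ polyForms n (r + 1) j) : ContDiff ℝ 1 v :=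
    (contDiff_of_mem_polyForms hv).of_le (by exact_mod_cast le_top)
  have := Submodule.finiteDimensional_of_le (lowSpace_le (n := n) r k κ₀)
  have := Submodule.finiteDimensional_of_le (highSpace_le (n := n) r (k + 1) κ₁)
  exact mainTheorem7_general hn _ _ (fun _ hτ => contDiff (lowSpace_le r k κ₀ hτ))
    (fun _ hv => contDiff (highSpace_le r (k + 1) κ₁ hv)) (isAffineInvariant_lowSpace r k κ₀)
    (isAffineInvariant_highSpace r (k + 1) κ₁) (fun _ hτ => extD_mem_highSpace κ₁ hτ) hγ
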